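/- There are $n$ cars $1,\dots,n$, entering in this order, and a one-way street with $n$ spots labeled $1,\dots,n$. Each car has a preferred spot and parks in the first spot on or after its preference that is not taken by an earlier car. A choice of preferences is a parking function of $1,\dots,n$ if every car is able to park. For a given parking function, a car is lucky if it parks in its preferred spot, and a spot is lucky if the car that parks in it prefers it. Let $q_n(i,j)$ be the number of parking functions of $1,\dots,n$ for which the $i$-th car prefers spot $j$ and is lucky. Then $\sum_{i=1}^n q_n(i,j)$ is the number of parking functions of $1,\dots,n$ for which spot $j$ is lucky, and \begin{align*} \sum_{i=1}^n q_n(i,3)&=\tfrac23(n+1)^{n-1}-\tfrac13(2n-1)(n-2)^{n-2} && (n\ge 3),\\ \sum_{i=1}^n q_n(i,4)&=\tfrac58(n+1)^{n-1}-\tfrac18(13n^2-26n+9)(n-3)^{n-3} && (n\ge 4),\\ \sum_{i=1}^n q_n(i,5)&=\tfrac35(n+1)^{n-1}-\tfrac1{30}(118n^3-531n^2+659n-192)(n-4)^{n-4} && (n\ge 5). \end{align*} Moreover, for $1\le j\le 5$ the limit $$\rho_j=\lim_{n\to\infty}\frac{1}{(n+1)^{n-1}}\sum_{i=1}^n q_n(i,j)$$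 exists and equals the limit as $n\to\infty$ of the probability that spot $j$ is lucky for a uniformly random parking function of $1,\dots,n$, and its values are $$\rho_1=1,\quad \rho_2=\tfrac34-\tfrac14e^{-2}=0.716166\ldots,\quad \rho_3=\tfrac23-\tfrac23e^{-3}=0.633475\ldots,$$ $$\rho_4=\tfrac58-\tfrac{13}8e^{-4}=0.595237\ldots,\quad \rho_5=\tfrac35-\tfrac{59}{15}e^{-5}=0.573497\ldots$$ -/

import Mathlib

open Filter Topology

namespace Parking

/-- There are `n` cars (entering in the order of `Fin n`) and `n` spots. The car `i` prefers
the spot `p i`. The map `s` is the outcome of parking when every car gets a spot: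
each car `i` parks in the first spot that is on or after its preference and
that is not taken by an earlier car. -/
def IsOutcome {n : ℕ} (p s : Fin n → Fin n) : Prop :=
  ∀ i, IsLeast {t : Fin n | p i ≤ t ∧ ∀ k, k < i → s k ≠ t} (s i)

/-- The outcome is determined by the preferences. -/
theorem IsOutcome.unique {n : ℕ} {p s s' : Fin n → Fin n}
    (h : IsOutcome p s) (h' : IsOutcome p s') : s = s' := by
  funext i
  induction i using WellFoundedLT.induction with
  | ind i ih =>
    have hset : {t : Fin n | p i ≤ t ∧ ∀ k, k < i → s k ≠ t} =
        {t : Fin n | p i ≤ t ∧ ∀ k, k < i → s' k ≠ t} := by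
      ext t
      constructor
      · rintro ⟨h1, h2⟩
        exact ⟨h1, fun k hk => by rw [← ih k hk]; exact h2 k hk⟩
      · rintro ⟨h1, h2⟩
        exact ⟨h1, fun k hk => by rw [ih k hk]; exact h2 k hk⟩
    have hi := h i
    rw [hset] at hi
    exact hi.unique (h' i)

/-- A parking function: preferences with which every car is able to park. -/
def IsParkingFunction {n : ℕ} (p : Fin n → Fin n) : Prop :=
  ∃ s, IsOutcome p s

/-- `p` is a parking function for which the car `i` is lucky: it parks in its preferred spot. -/
def IsLuckyCar {n : ℕ} (p : Fin n → Fin n) (i : Fin n) : Prop :=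
  ∃ s, IsOutcome p s ∧ s i = p i

/-- `p` is a parking function for which the spot `t` is lucky: a car that prefers `t` parks
in it. -/
def IsLuckySpot {n : ℕ} (p : Fin n → Fin n) (t : Fin n) : Prop :=
  ∃ s, IsOutcome p s ∧ ∃ i, s i = t ∧ p i = t

/-- The number of parking functions of `1, …, n`. -/
noncomputable def parkingCount (n : ℕ) : ℕ :=
  Set.ncard {p : Fin n → Fin n | IsParkingFunction p}

/-- The number of parking functions of `1, …, n` for which the spot with label `j` is lucky.
The spots carry the labels `1, …, n`, so `t : Fin n` is the spot with label `t + 1`. -/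
noncomputable def luckySpotCount (n j : ℕ) : ℕ :=
  Set.ncard {p : Fin n → Fin n | ∃ t : Fin n, (t : ℕ) + 1 = j ∧ IsLuckySpot p t}

/-- `q n i j` is the number of parking functions of `1, …, n` for which the car `i` prefers the
spot with label `j` and the car `i` is lucky. -/
noncomputable def q (n : ℕ) (i : Fin n) (j : ℕ) : ℕ :=
  Set.ncard {p : Fin n → Fin n | (p i : ℕ) + 1 = j ∧ IsLuckyCar p i}

/-- The `j`-th column sum: the sum of `q n i j` over all cars `i`. -/
noncomputable def columnSum (n j : ℕ) : ℕ :=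
  ∑ i : Fin n, q n i j

/-- The number `ρ` is the limit, as `n → ∞`, of the `j`-th column sum divided by
`(n + 1) ^ (n - 1)`, and of the probability that the spot with label `j` is lucky for a uniformly
random parking function of `1, …, n`. -/
def IsAsymptoticProbability (j : ℕ) (ρ : ℝ) : Prop :=
  Tendsto (fun n : ℕ => (columnSum n j : ℝ) / ((n : ℝ) + 1) ^ (n - 1)) atTop (𝓝 ρ) ∧
  Tendsto (fun n : ℕ => (luckySpotCount n j : ℝ) / (parkingCount n : ℝ)) atTop (𝓝 ρ)

end Parking

/-! Number the spots from `0` and fix the spot `t`. Whether `t` is lucky depends only on the cars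
preferring one of `0, …, t`: later preferences never touch these spots. A preference word of length
`n` is parking iff its letters at most `t` fill `0, …, t` (surplus cars drive on) and its remaining
letters satisfy the condition `Crit` on the other spots. The two subwords interleave freely, so the
parking functions with `t` unlucky are counted by a binomial convolution of `leftCount` with the
`Crit` words (`parkingCount_eq_luckySpotCount_add`).

The right factor has a closed form: `y = n - t` satisfies `y * count = (m - t) * y ^ (n - m)` when
`m` letters go left (`wordCount_crit`). The left factor comes from a recursion over the set of
occupied spots; for `t ≤ 4` and `m > t` it equals `W m = c (t+1)^m + ∑ d k * m.descFactorial k *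
(t-k)^m`, the sum over `k < t`.

In the convolution every `d k` term cancels, by the binomial theorem differentiated `k` times, and
the `c` term gives `c (n+1)^(n-1)`. What remains is a correction: `leftCount` is zero for `m < t`
but `W m` need not be. These few terms produce the factor `(n-t)^(n-t)` times a polynomial
(`luckySpotCount_eq`). Divided by `(n+1)^(n-1)`, the correction tends to a multiple of `e^(-(t+1))`.
-/

namespace Parking

/-! ### Counting words letter by letter. -/

/-- The number of words of length `n` over the alphabet `A` that satisfy `P`. -/
noncomputable def wordCount (A : Finset ℕ) : (List ℕ → Prop) → ℕ → ℕ
  | P, 0 => open Classical in if P [] then 1 else 0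
  | P, n + 1 => ∑ a ∈ A, wordCount A (fun w => P (a :: w)) n

theorem wordCount_congr {A : Finset ℕ} {n : ℕ} : ∀ {P Q : List ℕ → Prop},
    (∀ w : List ℕ, w.length = n → (∀ a ∈ w, a ∈ A) → (P w ↔ Q w)) →
    wordCount A P n = wordCount A Q n := by
  induction n with
  | zero =>
    intro P Q h
    have h0 := h [] rfl (by simp)
    by_cases hP : P []
    · simp [wordCount, hP, h0.1 hP]
    · simp [wordCount, hP, mt h0.2 hP]
  | succ n ih =>
    intro P Q h
    refine Finset.sum_congr rfl fun a ha => ih fun w hw hA => h (a :: w) (by simp [hw]) ?_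
    simpa [ha] using hA

theorem wordCount_false {A : Finset ℕ} {n : ℕ} {P : List ℕ → Prop}
    (h : ∀ w : List ℕ, w.length = n → (∀ a ∈ w, a ∈ A) → ¬ P w) : wordCount A P n = 0 := by
  have key : ∀ n, wordCount A (fun _ => False) n = 0 := by
    intro n
    induction n with
    | zero => simp [wordCount]
    | succ n ih => simp [wordCount, ih]
  rw [← key n]
  exact wordCount_congr fun w hw hA => by simp [h w hw hA]

theorem wordCount_singleton_true (a n : ℕ) : wordCount {a} (fun _ => True) n = 1 := by
  induction n with
  | zero => simp [wordCount]
  | succ n ih => simp [wordCount, ih]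

theorem wordCount_and_add_and_not (A : Finset ℕ) (n : ℕ) : ∀ P Q : List ℕ → Prop,
    wordCount A (fun w => P w ∧ Q w) n + wordCount A (fun w => P w ∧ ¬ Q w) n =
      wordCount A P n := by
  induction n with
  | zero =>
    intro P Q
    by_cases hP : P [] <;> by_cases hQ : Q [] <;> simp [wordCount, hP, hQ]
  | succ n ih =>
    intro P Q
    simp only [wordCount, ← Finset.sum_add_distrib, ih (fun w => P (_ :: w)) fun w => Q (_ :: w)]

/-- Words with independent conditions on the letters below `j` and on the other letters. -/
theorem wordCount_split (A : Finset ℕ) (j n : ℕ) : ∀ P Q : List ℕ → Prop,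
    wordCount A (fun w => P (w.filter (· < j)) ∧ Q (w.filter (j ≤ ·))) n =
      ∑ x ∈ Finset.HasAntidiagonal.antidiagonal n, n.choose x.1 *
        (wordCount (A.filter (· < j)) P x.1 * wordCount (A.filter (j ≤ ·)) Q x.2) := by
  induction n with
  | zero =>
    intro P Q
    by_cases hP : P [] <;> by_cases hQ : Q [] <;> simp [wordCount, hP, hQ]
  | succ n ih =>
    intro P Q
    -- Pascal's rule mirrors the choice of the first letter: its two sums correspond to a first
    -- letter at least `j` and below `j`.
    have hpascal := Finset.sum_antidiagonal_choose_succ_nsmul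
      (fun x y => wordCount (A.filter (· < j)) P x * wordCount (A.filter (j ≤ ·)) Q y) n
    simp only [smul_eq_mul] at hpascal
    rw [hpascal, wordCount, ← Finset.sum_filter_add_sum_filter_not A (· < j), add_comm]
    congr 1
    · have hset : A.filter (fun a => ¬ a < j) = A.filter (j ≤ ·) := by
        simp only [not_lt]
      rw [hset]
      have hterm : ∀ a ∈ A.filter (j ≤ ·),
          wordCount A (fun w => P ((a :: w).filter (· < j)) ∧ Q ((a :: w).filter (j ≤ ·))) n =
          ∑ x ∈ Finset.HasAntidiagonal.antidiagonal n,
            n.choose x.1 * (wordCount (A.filter (· < j)) P x.1 *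
              wordCount (A.filter (j ≤ ·)) (fun w => Q (a :: w)) x.2) := by
        intro a ha
        have ha' : j ≤ a := (Finset.mem_filter.1 ha).2
        rw [← ih P fun w => Q (a :: w)]
        simp [ha', not_lt.2 ha']
      rw [Finset.sum_congr rfl hterm, Finset.sum_comm]
      refine Finset.sum_congr rfl fun x _ => ?_
      rw [wordCount, Finset.mul_sum, Finset.mul_sum]
    · have hterm : ∀ a ∈ A.filter (· < j),
          wordCount A (fun w => P ((a :: w).filter (· < j)) ∧ Q ((a :: w).filter (j ≤ ·))) n =
          ∑ x ∈ Finset.HasAntidiagonal.antidiagonal n, n.choose x.1 *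
            (wordCount (A.filter (· < j)) (fun w => P (a :: w)) x.1 *
            wordCount (A.filter (j ≤ ·)) Q x.2) := by
        intro a ha
        have ha' : a < j := (Finset.mem_filter.1 ha).2
        rw [← ih (fun w => P (a :: w)) Q]
        simp [ha', not_le.2 ha']
      rw [Finset.sum_congr rfl hterm, Finset.sum_comm]
      refine Finset.sum_congr rfl fun x hx => ?_
      have hx' : n.choose x.2 = n.choose x.1 := by
        rw [← Finset.HasAntidiagonal.mem_antidiagonal.1 hx]
        exact (Nat.choose_symm_add (a := x.1) (b := x.2)).symm
      rw [wordCount, Finset.sum_mul, Finset.mul_sum, hx']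

theorem ncard_eq_wordCount (n m : ℕ) (P : List ℕ → Prop) :
    Set.ncard {p : Fin m → Fin n | P (List.ofFn fun i => (p i : ℕ))} =
      wordCount (Finset.range n) P m := by
  classical
  have key : ∀ (m : ℕ) (P : List ℕ → Prop),
      (∑ p : Fin m → Fin n, if P (List.ofFn fun i => (p i : ℕ)) then 1 else 0) =
        wordCount (Finset.range n) P m := by
    intro m
    induction m with
    | zero =>
      intro P
      simp [wordCount]
    | succ m ih =>
      intro P
      rw [← (Fin.consEquiv fun _ : Fin (m + 1) => Fin n).sum_comp, Fintype.sum_prod_type,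
        wordCount, Finset.sum_range]
      refine Finset.sum_congr rfl fun a _ => ?_
      rw [← ih fun w => P (a :: w)]
      simp [Fin.consEquiv, List.ofFn_succ]
  rw [← key, Set.ncard_eq_toFinset_card', Finset.card_eq_sum_ones, Set.toFinset_ofPred,
    Finset.sum_filter]

/-! ### Parking as a process on the set of occupied spots. -/

/-- The occupied spots, among `0, …, k - 1`, after a car with preference `a` arrives when the
spots in `S` are occupied. A car that finds no spot leaves. -/
def step (k : ℕ) (S : Finset ℕ) (a : ℕ) : Finset ℕ :=
  if h : (Finset.Ico a k \ S).Nonempty then insert ((Finset.Ico a k \ S).min' h) S else S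

/-- The occupied spots after the cars with the preferences in a list arrive. -/
def run (k : ℕ) (S : Finset ℕ) : List ℕ → Finset ℕ
  | [] => S
  | a :: w => run k (step k S a) w

/-- Every car with a preference in a list finds a spot. -/
def Parks (k : ℕ) (S : Finset ℕ) : List ℕ → Prop
  | [] => True
  | a :: w => (Finset.Ico a k \ S).Nonempty ∧ Parks k (step k S a) w

/-- The spot `t` is free until a car that prefers it arrives. -/
def Lucky (k t : ℕ) (S : Finset ℕ) : List ℕ → Prop
  | [] => False
  | a :: w => (a = t ∧ t ∉ S) ∨ Lucky k t (step k S a) w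

/-- The outcome of parking when the spots in `S` are occupied at the start. -/
def IsOutcomeFrom {n m : ℕ} (S : Finset ℕ) (p s : Fin m → Fin n) : Prop :=
  ∀ i, IsLeast {t : Fin n | p i ≤ t ∧ (t : ℕ) ∉ S ∧ ∀ k, k < i → s k ≠ t} (s i)

theorem isOutcomeFrom_empty {n : ℕ} {p s : Fin n → Fin n} :
    IsOutcomeFrom ∅ p s ↔ IsOutcome p s := by
  simp [IsOutcomeFrom, IsOutcome]

/-- The reason for a general initial set `S`: once the first car is parked, its spot joins `S`, and
induction on the cars applies. -/
theorem isOutcomeFrom_cons {n m : ℕ} {S : Finset ℕ} {a b : Fin n} {p s : Fin m → Fin n} :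
    IsOutcomeFrom S (Fin.cons a p : Fin (m + 1) → Fin n) (Fin.cons b s) ↔
      IsLeast {t : Fin n | a ≤ t ∧ (t : ℕ) ∉ S} b ∧ IsOutcomeFrom (insert (b : ℕ) S) p s := by
  have hset : ∀ i : Fin m, {t : Fin n | p i ≤ t ∧ (t : ℕ) ∉ S ∧
      ∀ k : Fin (m + 1), k < i.succ → (Fin.cons b s : Fin (m + 1) → Fin n) k ≠ t} =
      {t : Fin n | p i ≤ t ∧ (t : ℕ) ∉ insert (b : ℕ) S ∧ ∀ k, k < i → s k ≠ t} := by
    intro i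
    ext t
    simp only [Set.mem_ofPred_eq, Fin.forall_fin_succ, Fin.cons_zero, Fin.cons_succ,
      Fin.succ_lt_succ_iff, Fin.succ_pos, forall_true_left, Finset.mem_insert, not_or, ne_eq,
      Fin.ext_iff]
    tauto
  unfold IsOutcomeFrom
  rw [Fin.forall_fin_succ]
  simp only [Fin.cons_zero, Fin.cons_succ, hset, Fin.not_lt_zero, false_imp_iff, implies_true,
    and_true]

theorem isLeast_iff_step {n : ℕ} {S : Finset ℕ} {a b : Fin n} :
    IsLeast {t : Fin n | a ≤ t ∧ (t : ℕ) ∉ S} b ↔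
      ∃ h : (Finset.Ico (a : ℕ) n \ S).Nonempty, (Finset.Ico (a : ℕ) n \ S).min' h = b := by
  constructor
  · rintro ⟨⟨h1, h2⟩, h3⟩
    have hb : (b : ℕ) ∈ Finset.Ico (a : ℕ) n \ S := by
      simp [h2, Fin.le_def.1 h1]
    refine ⟨⟨b, hb⟩, le_antisymm (Finset.min'_le _ _ hb) (Finset.le_min' _ _ _ ?_)⟩
    intro y hy
    simp only [Finset.mem_sdiff, Finset.mem_Ico] at hy
    exact Fin.le_def.1 (h3 (a := ⟨y, hy.1.2⟩) ⟨Fin.le_def.2 hy.1.1, hy.2⟩)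
  · rintro ⟨h, hb⟩
    have hmem := Finset.min'_mem _ h
    rw [hb, Finset.mem_sdiff, Finset.mem_Ico] at hmem
    refine ⟨⟨Fin.le_def.2 hmem.1.1, hmem.2⟩, fun t ht => ?_⟩
    rw [Fin.le_def, ← hb]
    exact Finset.min'_le _ _ (by simp [ht.2, Fin.le_def.1 ht.1])

theorem step_of_isLeast {n : ℕ} {S : Finset ℕ} {a b : Fin n}
    (h : IsLeast {t : Fin n | a ≤ t ∧ (t : ℕ) ∉ S} b) : step n S a = insert (b : ℕ) S := by
  obtain ⟨h1, h2⟩ := isLeast_iff_step.1 h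
  simp only [step, h1, dite_true, h2]

theorem exists_isLeast_iff {n : ℕ} {S : Finset ℕ} {a : Fin n} :
    (∃ b, IsLeast {t : Fin n | a ≤ t ∧ (t : ℕ) ∉ S} b) ↔
      (Finset.Ico (a : ℕ) n \ S).Nonempty := by
  constructor
  · rintro ⟨b, hb⟩
    exact (isLeast_iff_step.1 hb).1
  · intro h
    have hmem := Finset.min'_mem _ h
    rw [Finset.mem_sdiff, Finset.mem_Ico] at hmem
    exact ⟨⟨_, hmem.1.2⟩, isLeast_iff_step.2 ⟨h, rfl⟩⟩

theorem exists_isOutcomeFrom_iff {n m : ℕ} {p : Fin m → Fin n} : ∀ {S : Finset ℕ},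
    (∃ s, IsOutcomeFrom S p s) ↔ Parks n S (List.ofFn fun i => (p i : ℕ)) := by
  induction m with
  | zero => simp [IsOutcomeFrom, Parks]
  | succ m ih =>
    intro S
    induction p using Fin.consCases with
    | _ a p =>
      simp only [List.ofFn_succ, Fin.cons_zero, Fin.cons_succ, Parks, ← ih, Fin.exists_fin_succ_pi,
        isOutcomeFrom_cons]
      constructor
      · rintro ⟨b, s, hb, hs⟩
        exact ⟨exists_isLeast_iff.1 ⟨b, hb⟩, s, by rwa [step_of_isLeast hb]⟩
      · rintro ⟨h, s, hs⟩
        obtain ⟨b, hb⟩ := exists_isLeast_iff.2 h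
        exact ⟨b, s, hb, by rwa [← step_of_isLeast hb]⟩

theorem exists_isOutcomeFrom_lucky_iff {n m : ℕ} {t : Fin n} {p : Fin m → Fin n} :
    ∀ {S : Finset ℕ}, (∃ s, IsOutcomeFrom S p s ∧ ∃ i, s i = t ∧ p i = t) ↔
      Parks n S (List.ofFn fun i => (p i : ℕ)) ∧
        Lucky n t S (List.ofFn fun i => (p i : ℕ)) := by
  induction m with
  | zero => simp [Lucky]
  | succ m ih =>
    intro S
    induction p using Fin.consCases with
    | _ a p =>
      simp only [List.ofFn_succ, Fin.cons_zero, Fin.cons_succ, Parks, Lucky,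
        Fin.exists_fin_succ_pi, isOutcomeFrom_cons, Fin.exists_fin_succ]
      constructor
      · rintro ⟨b, s, ⟨hb, hs⟩, h⟩
        rw [← step_of_isLeast hb] at hs
        refine ⟨⟨exists_isLeast_iff.1 ⟨b, hb⟩, exists_isOutcomeFrom_iff.1 ⟨s, hs⟩⟩, ?_⟩
        rcases h with ⟨rfl, rfl⟩ | h
        · exact Or.inl ⟨rfl, hb.1.2⟩
        · exact Or.inr (ih.1 ⟨s, hs, h⟩).2
      · rintro ⟨⟨h, hp⟩, hl⟩
        obtain ⟨b, hb⟩ := exists_isLeast_iff.2 h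
        rcases hl with ⟨hat, ht⟩ | hl
        · obtain ⟨s, hs⟩ := exists_isOutcomeFrom_iff.2 hp
          rw [step_of_isLeast hb] at hs
          refine ⟨b, s, ⟨hb, hs⟩, Or.inl ⟨?_, Fin.ext hat⟩⟩
          obtain rfl : a = t := Fin.ext hat
          exact le_antisymm (hb.2 ⟨le_rfl, ht⟩) hb.1.1
        · obtain ⟨s, hs, hi⟩ := ih.2 ⟨hp, hl⟩
          rw [step_of_isLeast hb] at hs
          exact ⟨b, s, ⟨hb, hs⟩, Or.inr hi⟩

/-! ### Filling all spots: the counting criterion. -/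

theorem step_subset {k : ℕ} {S : Finset ℕ} (a : ℕ) (hS : S ⊆ Finset.range k) :
    step k S a ⊆ Finset.range k := by
  unfold step
  split_ifs with h
  · have hmem := Finset.min'_mem _ h
    rw [Finset.mem_sdiff, Finset.mem_Ico] at hmem
    exact Finset.insert_subset (Finset.mem_range.2 hmem.1.2) hS
  · exact hS

theorem run_subset {k : ℕ} (w : List ℕ) : ∀ {S : Finset ℕ}, S ⊆ Finset.range k →
    run k S w ⊆ Finset.range k := by
  induction w with
  | nil => exact fun h => h
  | cons a w ih => exact fun h => ih (step_subset a h)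

theorem card_step (k : ℕ) (S : Finset ℕ) (a : ℕ) :
    ((Finset.Ico a k \ S).Nonempty ∧ (step k S a).card = S.card + 1) ∨
      (¬ (Finset.Ico a k \ S).Nonempty ∧ (step k S a).card = S.card) := by
  by_cases h : (Finset.Ico a k \ S).Nonempty
  · left
    have hmem := Finset.min'_mem _ h
    rw [Finset.mem_sdiff] at hmem
    simp only [step, h, dite_true, Finset.card_insert_of_notMem hmem.2, true_and]
  · right
    simp only [step, h, dite_false, not_false_eq_true, and_self]

theorem card_run_le (k : ℕ) (w : List ℕ) : ∀ S : Finset ℕ,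
    (run k S w).card ≤ S.card + w.length := by
  induction w with
  | nil => intro S; simp [run]
  | cons a w ih =>
    intro S
    have h1 := ih (step k S a)
    simp only [run, List.length_cons]
    rcases card_step k S a with h | h <;> omega

theorem parks_iff_card_run (k : ℕ) (w : List ℕ) : ∀ S : Finset ℕ,
    Parks k S w ↔ (run k S w).card = S.card + w.length := by
  induction w with
  | nil => intro S; simp [run, Parks]
  | cons a w ih =>
    intro S
    have h1 := card_run_le k w (step k S a)
    simp only [run, Parks, List.length_cons, ih]
    rcases card_step k S a with h | h
    · rw [h.2]
      simp only [h.1, true_and]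
      omega
    · simp only [h.1, false_and, false_iff]
      omega

theorem parks_iff_run_eq {n : ℕ} {w : List ℕ} (hw : w.length = n) :
    Parks n ∅ w ↔ run n ∅ w = Finset.range n := by
  rw [parks_iff_card_run, hw, Finset.card_empty, zero_add]
  constructor
  · intro h
    exact Finset.eq_of_subset_of_card_le (run_subset w (Finset.empty_subset _)) (by simp [h])
  · intro h
    simp [h]

/-- All spots get filled if and only if, for every `t ≤ k`, there are at least `t` cars
that prefer the first `t` spots. -/
theorem run_eq_range_iff (k : ℕ) (w : List ℕ) : ∀ {S : Finset ℕ}, S ⊆ Finset.range k →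
    (run k S w = Finset.range k ↔
      ∀ t ≤ k, t ≤ (S.filter (· < t)).card + (w.filter (· < t)).length) := by
  induction w with
  | nil =>
    intro S hS
    simp only [run, List.filter_nil, List.length_nil, add_zero]
    constructor
    · rintro rfl t ht
      have : (Finset.range k).filter (· < t) = Finset.range t := by
        ext x; simp; omega
      simp [this]
    · intro h
      refine Finset.eq_of_subset_of_card_le hS ?_
      rw [Finset.card_range]
      exact (h k le_rfl).trans (Finset.card_filter_le _ _)
  | cons a w ih =>
    intro S hS
    rw [run, ih (step_subset a hS)]
    have hmono : ∀ t, a ≤ t → (w.filter (· < a)).length ≤ (w.filter (· < t)).length := by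
      intro t hat
      simp only [← List.countP_eq_length_filter]
      refine List.countP_mono_left fun x _ hx => ?_
      simp only [decide_eq_true_eq] at hx ⊢
      omega
    -- If all of `[a, t)` is occupied, the inequality at `a` gains `t - a` and implies the one at
    -- `t`.
    have hblock : ∀ t, a ≤ t → Finset.Ico a t ⊆ S →
        (S.filter (· < a)).card + (t - a) ≤ (S.filter (· < t)).card := by
      intro t hat hsub
      have hdisj : Disjoint (S.filter (· < a)) (Finset.Ico a t) := by
        rw [Finset.disjoint_left]
        intro x hx hx'
        simp only [Finset.mem_filter, Finset.mem_Ico] at hx hx'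
        omega
      rw [← Nat.card_Ico a t, ← Finset.card_union_of_disjoint hdisj]
      refine Finset.card_le_card fun x hx => ?_
      simp only [Finset.mem_union, Finset.mem_filter, Finset.mem_Ico] at hx ⊢
      rcases hx with hx | hx
      · exact ⟨hx.1, by omega⟩
      · exact ⟨hsub (Finset.mem_Ico.2 hx), hx.2⟩
    by_cases h : (Finset.Ico a k \ S).Nonempty
    · have hmem := Finset.min'_mem _ h
      have hstep : step k S a = insert ((Finset.Ico a k \ S).min' h) S := by
        simp only [step, h, dite_true]
      have hmin : Finset.Ico a ((Finset.Ico a k \ S).min' h) ⊆ S := by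
        intro x hx
        by_contra hxS
        have hb := Finset.min'_mem _ h
        simp only [Finset.mem_sdiff, Finset.mem_Ico] at hx hb
        have := Finset.min'_le (Finset.Ico a k \ S) x (by
          simp only [Finset.mem_sdiff, Finset.mem_Ico]
          exact ⟨⟨hx.1, hx.2.trans hb.1.2⟩, hxS⟩)
        omega
      rw [hstep]
      generalize (Finset.Ico a k \ S).min' h = b at hmem hmin
      simp only [Finset.mem_sdiff, Finset.mem_Ico] at hmem
      have hcard : ∀ t, ((insert b S).filter (· < t)).card =
          (S.filter (· < t)).card + if b < t then 1 else 0 := by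
        intro t
        rw [Finset.filter_insert]
        split_ifs with hbt
        · rw [Finset.card_insert_of_notMem (by simp [hmem.2])]
        · rfl
      have hlen : ∀ t, ((a :: w).filter (· < t)).length =
          (w.filter (· < t)).length + if a < t then 1 else 0 := by
        intro t
        by_cases hat : a < t <;> simp [hat]
      simp only [hcard, hlen]
      constructor
      · intro H t ht
        have := H t ht
        split_ifs at this ⊢ <;> omega
      -- The inequalities before and after the step differ only for `a < t ≤ b`. There `[a, t)` is
      -- occupied, so the inequality at `a` suffices.
      · intro H t ht
        have h1 := H t ht
        have h2 := H a (by omega)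
        by_cases hbt : b < t
        · simp only [hbt, if_true] at h1 ⊢
          split_ifs at h1 <;> omega
        · by_cases hat : a < t
          · have h3 := hmono t hat.le
            have h4 := hblock t hat.le ((Finset.Ico_subset_Ico_right (by omega)).trans hmin)
            simp only [lt_irrefl, if_false] at h2
            omega
          · simp only [hbt, hat, if_false] at h1 ⊢
            omega
    · have hstep : step k S a = S := by simp only [step, h, dite_false]
      have hsub : Finset.Ico a k ⊆ S := by
        rwa [Finset.not_nonempty_iff_eq_empty, Finset.sdiff_eq_empty_iff_subset] at h
      have hlen : ∀ t, ((a :: w).filter (· < t)).length =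
          (w.filter (· < t)).length + if a < t then 1 else 0 := by
        intro t
        by_cases hat : a < t <;> simp [hat]
      rw [hstep]
      simp only [hlen]
      constructor
      · intro H t ht
        exact (H t ht).trans (by omega)
      -- The car leaves because `[a, k)` is full; for `t > a` the inequality again follows from the
      -- one at `a`.
      · intro H t ht
        have h1 := H t ht
        by_cases hat : a < t
        · have h2 := H a (by omega)
          have h3 := hmono t hat.le
          have h4 := hblock t hat.le ((Finset.Ico_subset_Ico_right ht).trans hsub)
          simp only [lt_irrefl, if_false] at h2
          omega
        · simpa [hat] using h1

/-! ### Cutting the street at a spot `j`. -/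

/-- Trades the minimum for a condition on the spots between `a` and `x`, which makes streets of
different lengths comparable. -/
theorem mem_step {k : ℕ} {S : Finset ℕ} {a x : ℕ} : x ∈ step k S a ↔
    x ∈ S ∨ (a ≤ x ∧ x < k ∧ ∀ y, a ≤ y → y < x → y ∈ S) := by
  unfold step
  split_ifs with h
  · have hb := Finset.min'_mem _ h
    have hmin : ∀ y ∈ Finset.Ico a k \ S, (Finset.Ico a k \ S).min' h ≤ y :=
      fun y => Finset.min'_le _ y
    generalize (Finset.Ico a k \ S).min' h = b at hb hmin
    simp only [Finset.mem_sdiff, Finset.mem_Ico] at hb hmin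
    rw [Finset.mem_insert]
    constructor
    · rintro (rfl | hx)
      · refine Or.inr ⟨hb.1.1, hb.1.2, fun y hay hyx => ?_⟩
        by_contra hy
        have := hmin y ⟨⟨hay, hyx.trans hb.1.2⟩, hy⟩
        omega
      · exact Or.inl hx
    · rintro (hx | ⟨hax, hxk, hx⟩)
      · exact Or.inr hx
      · by_cases hxS : x ∈ S
        · exact Or.inr hxS
        · refine Or.inl (le_antisymm ?_ (hmin x ⟨⟨hax, hxk⟩, hxS⟩))
          by_contra hlt
          exact hb.2 (hx b hb.1.1 (by omega))
  · refine ⟨Or.inl, ?_⟩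
    rintro (hx | ⟨hax, hxk, -⟩)
    · exact hx
    · by_contra hxS
      exact h ⟨x, by simp [hax, hxk, hxS]⟩

/-- A car preferring `j` or later never enters the first `j` spots. A car with an earlier preference
that finds them full from there on drives past `j`, which the street of length `j` records as
leaving. -/
theorem step_inter_range {j n : ℕ} (hjn : j ≤ n) (S : Finset ℕ) (a : ℕ) :
    step n S a ∩ Finset.range j =
      if a < j then step j (S ∩ Finset.range j) a else S ∩ Finset.range j := by
  ext x
  split_ifs with ha
  · simp only [Finset.mem_inter, Finset.mem_range, mem_step]
    constructor
    · rintro ⟨hx | ⟨h1, h2, h3⟩, hxj⟩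
      · exact Or.inl ⟨hx, hxj⟩
      · exact Or.inr ⟨h1, hxj, fun y hy hyx => ⟨h3 y hy hyx, hyx.trans hxj⟩⟩
    · rintro (⟨hx, hxj⟩ | ⟨h1, h2, h3⟩)
      · exact ⟨Or.inl hx, hxj⟩
      · exact ⟨Or.inr ⟨h1, h2.trans_le hjn, fun y hy hyx => (h3 y hy hyx).1⟩, h2⟩
  · simp only [Finset.mem_inter, Finset.mem_range, mem_step]
    constructor
    · rintro ⟨hx | ⟨h1, -⟩, hxj⟩
      · exact ⟨hx, hxj⟩
      · omega
    · rintro ⟨hx, hxj⟩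
      exact ⟨Or.inl hx, hxj⟩

theorem lucky_iff {n j t : ℕ} (hjn : j ≤ n) (htj : t < j) (w : List ℕ) : ∀ S : Finset ℕ,
    Lucky n t S w ↔ Lucky j t (S ∩ Finset.range j) (w.filter (· < j)) := by
  induction w with
  | nil => intro S; simp [Lucky]
  | cons a w ih =>
    intro S
    rw [Lucky, ih, step_inter_range hjn]
    by_cases ha : a < j
    · simp [ha, Lucky, htj]
    · have : a ≠ t := by omega
      simp [ha, this]

/-- For every `t` in `[lo, hi]`, at most `hi - t` letters are at least `t`. -/
def Crit (lo hi : ℕ) (w : List ℕ) : Prop :=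
  ∀ t, lo ≤ t → t ≤ hi → (w.filter (t ≤ ·)).length + t ≤ hi

theorem length_filter_lt_add (w : List ℕ) (t : ℕ) :
    (w.filter (· < t)).length + (w.filter (t ≤ ·)).length = w.length := by
  induction w with
  | nil => rfl
  | cons a w ih =>
    by_cases h : a < t
    · simp [h, not_le.2 h, ← ih]; omega
    · simp [h, not_lt.1 h, ← ih]; omega

theorem filter_lt_filter_lt (w : List ℕ) {t j : ℕ} (h : t ≤ j) :
    (w.filter (· < j)).filter (· < t) = w.filter (· < t) := by
  rw [List.filter_filter]
  refine List.filter_congr fun x _ => ?_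
  by_cases hx : x < t
  · simp [hx, hx.trans_le h]
  · simp [hx]

theorem filter_le_filter_le (w : List ℕ) {t j : ℕ} (h : j ≤ t) :
    (w.filter (j ≤ ·)).filter (t ≤ ·) = w.filter (t ≤ ·) := by
  rw [List.filter_filter]
  refine List.filter_congr fun x _ => ?_
  by_cases hx : t ≤ x
  · simp [hx, h.trans hx]
  · simp [hx]

/-- The counting criterion for `t ≤ j` sees only the letters below `j`. For `t ≥ j`, the length
being `n` turns "at least `t` letters below `t`" into "at most `n - t` letters from `t` on". -/
theorem parks_iff {n j : ℕ} (hjn : j ≤ n) {w : List ℕ} (hw : w.length = n) :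
    Parks n ∅ w ↔ run j ∅ (w.filter (· < j)) = Finset.range j ∧ Crit j n (w.filter (j ≤ ·)) := by
  rw [parks_iff_run_eq hw, run_eq_range_iff n w (Finset.empty_subset _),
    run_eq_range_iff j _ (Finset.empty_subset _)]
  simp only [Finset.filter_empty, Finset.card_empty, zero_add, Crit]
  constructor
  · intro h
    refine ⟨fun t ht => ?_, fun t ht htn => ?_⟩
    · rw [filter_lt_filter_lt w ht]
      exact h t (ht.trans hjn)
    · rw [filter_le_filter_le w ht]
      have h1 := h t htn
      have h2 := length_filter_lt_add w t
      omega
  · rintro ⟨h1, h2⟩ t ht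
    by_cases htj : t ≤ j
    · have := h1 t htj
      rwa [filter_lt_filter_lt w htj] at this
    · have h3 := h2 t (by omega) ht
      rw [filter_le_filter_le w (by omega)] at h3
      have h4 := length_filter_lt_add w t
      omega

/-- At `t = lo` the condition only bounds the length; for larger `t` the letters equal to `lo` do
not count. -/
theorem crit_succ {lo hi : ℕ} (h : lo < hi) {w : List ℕ} (hlo : ∀ a ∈ w, lo ≤ a) :
    Crit lo hi w ↔ w.length + lo ≤ hi ∧ Crit (lo + 1) hi (w.filter (lo + 1 ≤ ·)) := by
  have hfil : w.filter (lo ≤ ·) = w := List.filter_eq_self.2 fun a ha => by simp [hlo a ha]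
  constructor
  · intro H
    refine ⟨by simpa only [hfil] using H lo le_rfl h.le, fun t ht hthi => ?_⟩
    rw [filter_le_filter_le w ht]
    exact H t (by omega) hthi
  · rintro ⟨h1, h2⟩ t ht hthi
    by_cases hlt : lo + 1 ≤ t
    · have := h2 t hlt hthi
      rwa [filter_le_filter_le w hlt] at this
    · obtain rfl : t = lo := by omega
      rwa [hfil]

/-! ### Binomial sums and the number of right words. -/

theorem wordCount_crit_of_lt {A : Finset ℕ} {lo s r : ℕ} (hA : ∀ a ∈ A, lo ≤ a) (h : s < r) :
    wordCount A (Crit lo (lo + s)) r = 0 := by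
  refine wordCount_false fun w hw hwA H => ?_
  have := H lo le_rfl (by omega)
  rw [List.filter_eq_self.2 fun a ha => by simp [hA a (hwA a ha)]] at this
  omega

/-- The binomial theorem for `(x + z) ^ n`, differentiated `k` times in `x` and multiplied by `x ^
k`. -/
theorem sum_choose_mul_descFactorial (k : ℕ) (x z : ℝ) : ∀ n : ℕ,
    ∑ y ∈ Finset.HasAntidiagonal.antidiagonal n,
      (n.choose y.1 : ℝ) * (y.1.descFactorial k * x ^ y.1 * z ^ y.2) =
    n.descFactorial k * x ^ k * (x + z) ^ (n - k) := by
  induction k with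
  | zero =>
    intro n
    simp only [Nat.descFactorial_zero, Nat.cast_one, one_mul, pow_zero, Nat.sub_zero]
    rw [add_pow, Finset.Nat.sum_antidiagonal_eq_sum_range_succ
      fun i j => (n.choose i : ℝ) * (x ^ i * z ^ j)]
    exact Finset.sum_congr rfl fun i _ => by ring
  | succ k ih =>
    intro n
    rcases n with _ | n
    · simp
    · rw [Finset.Nat.sum_antidiagonal_succ]
      have hterm : ∀ y ∈ Finset.HasAntidiagonal.antidiagonal n,
          ((n + 1).choose (y.1 + 1) : ℝ) *
            ((y.1 + 1).descFactorial (k + 1) * x ^ (y.1 + 1) * z ^ y.2) =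
          ((n + 1 : ℝ) * x) * ((n.choose y.1 : ℝ) * (y.1.descFactorial k * x ^ y.1 * z ^ y.2)) := by
        intro y _
        have hc : ((n + 1 : ℕ) : ℝ) * n.choose y.1 = (n + 1).choose (y.1 + 1) * (y.1 + 1 : ℕ) := by
          exact_mod_cast Nat.add_one_mul_choose_eq n y.1
        rw [Nat.succ_descFactorial_succ]
        push_cast at hc ⊢
        linear_combination (-(y.1.descFactorial k * x ^ (y.1 + 1) * z ^ y.2 : ℝ)) * hc
      rw [Finset.sum_congr rfl hterm, ← Finset.mul_sum, ih, Nat.succ_descFactorial_succ]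
      simp only [Nat.zero_descFactorial_succ, Nat.add_sub_add_right]
      push_cast
      ring

theorem sum_choose_mul_sub_mul_pow (x : ℝ) (r : ℕ) :
    ∑ y ∈ Finset.HasAntidiagonal.antidiagonal r, (r.choose y.1 : ℝ) * ((x - y.2) * x ^ y.2) =
      x * (x + 1) ^ r - r * x * (x + 1) ^ (r - 1) := by
  have h0 := sum_choose_mul_descFactorial 0 x 1 r
  have h1 := sum_choose_mul_descFactorial 1 x 1 r
  simp only [Nat.descFactorial_zero, Nat.descFactorial_one, Nat.cast_one, one_mul, pow_zero,
    Nat.sub_zero, one_pow, mul_one, pow_one] at h0 h1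
  rw [← h1, ← h0, Finset.mul_sum, ← Finset.sum_sub_distrib, ← Finset.Nat.sum_antidiagonal_swap]
  refine Finset.sum_congr rfl fun y hy => ?_
  rw [← Finset.HasAntidiagonal.mem_antidiagonal.1 hy, Prod.fst_swap, Prod.snd_swap,
    Nat.choose_symm_add]
  ring

/-- The number of words of `r` letters that fill the last `r` of `s` spots. -/
theorem wordCount_crit (s : ℕ) : ∀ lo r : ℕ, r ≤ s + 1 →
    ((s : ℝ) + 1) * wordCount (Finset.Ico lo (lo + s)) (Crit lo (lo + s)) r =
      ((s : ℝ) + 1 - r) * ((s : ℝ) + 1) ^ r := by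
  induction s with
  | zero =>
    intro lo r hr
    interval_cases r
    · simp [wordCount, Crit]
    · simp [wordCount]
  | succ s ih =>
    intro lo r hr
    -- One letter too many: both sides vanish. This boundary case belongs to the statement because
    -- the recursion below calls `ih` with up to `s + 1` letters.
    rcases Nat.lt_or_ge (s + 1) r with h | h
    · obtain rfl : r = s + 1 + 1 := by omega
      rw [wordCount_crit_of_lt (by simp +contextual) h]
      push_cast
      ring
    · have hcongr : wordCount (Finset.Ico lo (lo + (s + 1))) (Crit lo (lo + (s + 1))) r =
          wordCount (Finset.Ico lo (lo + (s + 1))) (fun w =>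
            (fun _ => True) (w.filter (· < lo + 1)) ∧
              Crit (lo + 1) (lo + 1 + s) (w.filter (lo + 1 ≤ ·))) r := by
        refine wordCount_congr fun w hw hA => ?_
        rw [crit_succ (by omega) fun a ha => (Finset.mem_Ico.1 (hA a ha)).1, hw,
          show lo + (s + 1) = lo + 1 + s by ring]
        simp only [true_and, and_iff_right_iff_imp]
        omega
      have hB : (Finset.Ico lo (lo + (s + 1))).filter (· < lo + 1) = {lo} := by
        ext x; simp; omega
      have hC : (Finset.Ico lo (lo + (s + 1))).filter (lo + 1 ≤ ·) =
          Finset.Ico (lo + 1) (lo + 1 + s) := by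
        ext x; simp; omega
      rw [hcongr, wordCount_split _ _ _ (fun _ => True) (Crit (lo + 1) (lo + 1 + s)), hB, hC]
      have hs : (s : ℝ) + 1 ≠ 0 := by positivity
      have hterm : ∀ y ∈ Finset.HasAntidiagonal.antidiagonal r,
          ((r.choose y.1 * (wordCount {lo} (fun _ => True) y.1 *
            wordCount (Finset.Ico (lo + 1) (lo + 1 + s)) (Crit (lo + 1) (lo + 1 + s)) y.2) : ℕ) : ℝ) =
          (r.choose y.1 : ℝ) * (((s : ℝ) + 1 - y.2) * ((s : ℝ) + 1) ^ y.2) / ((s : ℝ) + 1) := by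
        intro y hy
        have hyr := Finset.HasAntidiagonal.mem_antidiagonal.1 hy
        rw [wordCount_singleton_true, ← ih (lo + 1) y.2 (by omega)]
        push_cast
        field_simp
      rw [Nat.cast_sum, Finset.sum_congr rfl hterm, ← Finset.sum_div, sum_choose_mul_sub_mul_pow]
      push_cast
      rcases r with _ | r
      · simp
        field_simp
      · simp only [Nat.add_sub_cancel, pow_succ]
        field_simp

/-! ### Unlucky left words and the convolution formula. -/

/-- The number of words of length `m` over `0, …, t` after which the spots `0, …, t` are occupied,
where the spots in `S` are occupied at the start and `t` does not become lucky. -/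
noncomputable def leftCount (t : ℕ) (S : Finset ℕ) (m : ℕ) : ℕ :=
  wordCount (Finset.range (t + 1))
    (fun w => run (t + 1) S w = Finset.range (t + 1) ∧ ¬ Lucky (t + 1) t S w) m

theorem leftCount_zero (t : ℕ) (S : Finset ℕ) :
    leftCount t S 0 = if S = Finset.range (t + 1) then 1 else 0 := by
  simp [leftCount, wordCount, run, Lucky]

/-- Condition on the first car; one that prefers `t` while `t` is free makes `t` lucky and
contributes nothing. -/
theorem leftCount_succ (t : ℕ) (S : Finset ℕ) (m : ℕ) :
    leftCount t S (m + 1) = ∑ a : Fin (t + 1),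
      if (a : ℕ) = t ∧ t ∉ S then 0 else leftCount t (step (t + 1) S a) m := by
  rw [leftCount, wordCount, Finset.sum_range]
  refine Finset.sum_congr rfl fun a _ => ?_
  split_ifs with h
  · exact wordCount_false fun w _ _ => by simp [Lucky, h]
  · exact wordCount_congr fun w _ _ => by simp [Lucky, h, run]

theorem leftCount_of_lt {t m : ℕ} (h : m < t + 1) : leftCount t ∅ m = 0 := by
  refine wordCount_false fun w hw _ H => ?_
  have := card_run_le (t + 1) w ∅
  rw [H.1] at this
  simp at this
  omega

theorem parkingCount_eq_wordCount (n : ℕ) :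
    parkingCount n = wordCount (Finset.range n) (Parks n ∅) n := by
  rw [← ncard_eq_wordCount]
  simp only [parkingCount, IsParkingFunction, ← isOutcomeFrom_empty, exists_isOutcomeFrom_iff]

theorem luckySpotCount_eq_wordCount {n t : ℕ} (h : t < n) :
    luckySpotCount n (t + 1) =
      wordCount (Finset.range n) (fun w => Parks n ∅ w ∧ Lucky n t ∅ w) n := by
  rw [← ncard_eq_wordCount]
  refine congrArg Set.ncard (Set.ext fun p => ?_)
  have key := exists_isOutcomeFrom_lucky_iff (t := ⟨t, h⟩) (p := p) (S := ∅)
  simp only [isOutcomeFrom_empty] at key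
  rw [Set.mem_ofPred_eq, Set.mem_ofPred_eq, ← key]
  constructor
  · rintro ⟨t', ht', hl⟩
    obtain rfl : t' = ⟨t, h⟩ := Fin.ext (by simpa using ht')
    exact hl
  · exact fun hl => ⟨⟨t, h⟩, rfl, hl⟩

/-- Cut at `j = 0`: every letter lies on the right, and `wordCount_crit` with `r = s = n` has the
factor `s + 1 - r = 1`. -/
theorem parkingCount_eq (n : ℕ) : parkingCount n = (n + 1) ^ (n - 1) := by
  have h1 : parkingCount n = wordCount (Finset.Ico 0 (0 + n)) (Crit 0 (0 + n)) n := by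
    rw [parkingCount_eq_wordCount, zero_add, ← Finset.range_eq_Ico]
    refine wordCount_congr fun w hw _ => ?_
    have hall : w.filter (0 ≤ ·) = w := by simp
    have hnone : w.filter (· < 0) = [] := by simp
    rw [parks_iff (Nat.zero_le n) hw, hall, hnone]
    simp [run]
  have h2 := wordCount_crit n 0 n (by omega)
  rw [← h1] at h2
  have h3 : ((n : ℝ) + 1) ≠ 0 := by positivity
  have h4 : (parkingCount n : ℝ) = ((n : ℝ) + 1) ^ (n - 1) := by
    rcases n with _ | n
    · simpa using h2
    · refine mul_left_cancel₀ h3 (h2.trans ?_)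
      rw [← pow_succ']
      simp
  exact_mod_cast h4

theorem parkingCount_eq_luckySpotCount_add {n t : ℕ} (h : t < n) :
    parkingCount n = luckySpotCount n (t + 1) +
      ∑ x ∈ Finset.HasAntidiagonal.antidiagonal n, n.choose x.1 * (leftCount t ∅ x.1 *
        wordCount (Finset.Ico (t + 1) n) (Crit (t + 1) n) x.2) := by
  have hB : (Finset.range n).filter (· < t + 1) = Finset.range (t + 1) := by
    ext x; simp; omega
  have hC : (Finset.range n).filter (t + 1 ≤ ·) = Finset.Ico (t + 1) n := by
    ext x; simp; omega
  rw [parkingCount_eq_wordCount, luckySpotCount_eq_wordCount h,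
    ← wordCount_and_add_and_not _ _ _ (Lucky n t ∅)]
  congr 1
  have := wordCount_split (Finset.range n) (t + 1) n
    (fun w => run (t + 1) ∅ w = Finset.range (t + 1) ∧ ¬ Lucky (t + 1) t ∅ w) (Crit (t + 1) n)
  rw [hB, hC] at this
  simp only [leftCount]
  rw [← this]
  refine wordCount_congr fun w hw _ => ?_
  rw [parks_iff h hw, lucky_iff h (Nat.lt_succ_self t), Finset.empty_inter]
  tauto

/-! ### Transition tables for `t = 1, …, 4`. -/

/-- The vector `T` lists the successor states, so that `decide` can verify each table row. -/
theorem leftCount_succ_of_mem {t : ℕ} {S : Finset ℕ} (h : t ∈ S) (T : Fin (t + 1) → Finset ℕ)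
    (hT : ∀ a : Fin (t + 1), step (t + 1) S a = T a) (m : ℕ) :
    (leftCount t S (m + 1) : ℝ) = ∑ a, (leftCount t (T a) m : ℝ) := by
  simp [leftCount_succ, h, hT]

theorem leftCount_succ_of_notMem {t : ℕ} {S : Finset ℕ} (h : t ∉ S) (T : Fin t → Finset ℕ)
    (hT : ∀ a : Fin t, step (t + 1) S a = T a) (m : ℕ) :
    (leftCount t S (m + 1) : ℝ) = ∑ a, (leftCount t (T a) m : ℝ) := by
  rw [leftCount_succ, Fin.sum_univ_castSucc]
  simp [h, hT, fun a : Fin t => a.2.ne]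

/-- In these names the word is `t` and the digits are the occupied spots. A state containing `t` is
kept by exactly the preferences `a` with `[a, t]` occupied; their number is the base of the power
its own recursion contributes. -/
theorem leftCount_one_01 (m : ℕ) : (leftCount 1 {0, 1} m : ℝ) =
    2 ^ m := by
  induction m with
  | zero =>
    rw [leftCount_zero, if_pos (by decide)]
    norm_num
  | succ m ih =>
    rw [(leftCount_succ_of_mem (by decide)
      ![{0, 1}, {0, 1}] (by decide) m).trans
      (Fin.sum_univ_two _)]
    simp only [Matrix.cons_val, ih]
    ring

/-- While `t` is free, every car with preference below `t` parks. The state then always grows, so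
one recursion step replaces induction; the shift of `m` is the number of free spots. -/
theorem leftCount_one_0 (m : ℕ) : (leftCount 1 {0} (m + 1) : ℝ) =
    2 ^ m := by
  rw [leftCount_succ_of_notMem (by decide) ![{0, 1}] (by decide)]
  simp only [Fin.sum_univ_one, Matrix.cons_val, leftCount_one_01]

theorem leftCount_one_empty (m : ℕ) : (leftCount 1 ∅ (m + 2) : ℝ) =
    2 ^ m := by
  rw [leftCount_succ_of_notMem (by decide) ![{0}] (by decide)]
  simp only [Fin.sum_univ_one, Matrix.cons_val, leftCount_one_0]

theorem leftCount_two_012 (m : ℕ) : (leftCount 2 {0, 1, 2} m : ℝ) =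
    3 ^ m := by
  induction m with
  | zero =>
    rw [leftCount_zero, if_pos (by decide)]
    norm_num
  | succ m ih =>
    rw [(leftCount_succ_of_mem (by decide)
      ![{0, 1, 2}, {0, 1, 2}, {0, 1, 2}] (by decide) m).trans
      (Fin.sum_univ_three _)]
    simp only [Matrix.cons_val, ih]
    ring

theorem leftCount_two_12 (m : ℕ) : (leftCount 2 {1, 2} m : ℝ) =
    3 ^ m - 2 ^ m := by
  induction m with
  | zero =>
    rw [leftCount_zero, if_neg (by decide)]
    norm_num
  | succ m ih =>
    rw [(leftCount_succ_of_mem (by decide)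
      ![{0, 1, 2}, {1, 2}, {1, 2}] (by decide) m).trans
      (Fin.sum_univ_three _)]
    simp only [Matrix.cons_val, leftCount_two_012, ih]
    ring

theorem leftCount_two_01 (m : ℕ) : (leftCount 2 {0, 1} (m + 1) : ℝ) =
    2 * 3 ^ m := by
  rw [leftCount_succ_of_notMem (by decide) ![{0, 1, 2}, {0, 1, 2}] (by decide)]
  simp only [Fin.sum_univ_two, Matrix.cons_val, leftCount_two_012]
  ring

theorem leftCount_two_0 (m : ℕ) : (leftCount 2 {0} (m + 2) : ℝ) =
    4 * 3 ^ m := by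
  rw [leftCount_succ_of_notMem (by decide) ![{0, 1}, {0, 1}] (by decide)]
  simp only [Fin.sum_univ_two, Matrix.cons_val, leftCount_two_01]
  ring

theorem leftCount_two_1 (m : ℕ) : (leftCount 2 {1} (m + 2) : ℝ) =
    5 * 3 ^ m - 2 * 2 ^ m := by
  rw [leftCount_succ_of_notMem (by decide) ![{0, 1}, {1, 2}] (by decide)]
  simp only [Fin.sum_univ_two, Matrix.cons_val, leftCount_two_01, leftCount_two_12]
  ring

theorem leftCount_two_empty (m : ℕ) : (leftCount 2 ∅ (m + 3) : ℝ) =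
    9 * 3 ^ m - 2 * 2 ^ m := by
  rw [leftCount_succ_of_notMem (by decide) ![{0}, {1}] (by decide)]
  simp only [Fin.sum_univ_two, Matrix.cons_val, leftCount_two_0, leftCount_two_1]
  ring

theorem leftCount_three_0123 (m : ℕ) : (leftCount 3 {0, 1, 2, 3} m : ℝ) =
    4 ^ m := by
  induction m with
  | zero =>
    rw [leftCount_zero, if_pos (by decide)]
    norm_num
  | succ m ih =>
    rw [(leftCount_succ_of_mem (by decide)
      ![{0, 1, 2, 3}, {0, 1, 2, 3}, {0, 1, 2, 3}, {0, 1, 2, 3}] (by decide) m).trans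
      (Fin.sum_univ_four _)]
    simp only [Matrix.cons_val, ih]
    ring

theorem leftCount_three_023 (m : ℕ) : (leftCount 3 {0, 2, 3} m : ℝ) =
    4 ^ m - 2 ^ m := by
  induction m with
  | zero =>
    rw [leftCount_zero, if_neg (by decide)]
    norm_num
  | succ m ih =>
    rw [(leftCount_succ_of_mem (by decide)
      ![{0, 1, 2, 3}, {0, 1, 2, 3}, {0, 2, 3}, {0, 2, 3}] (by decide) m).trans
      (Fin.sum_univ_four _)]
    simp only [Matrix.cons_val, leftCount_three_0123, ih]
    ring

theorem leftCount_three_123 (m : ℕ) : (leftCount 3 {1, 2, 3} m : ℝ) =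
    4 ^ m - 3 ^ m := by
  induction m with
  | zero =>
    rw [leftCount_zero, if_neg (by decide)]
    norm_num
  | succ m ih =>
    rw [(leftCount_succ_of_mem (by decide)
      ![{0, 1, 2, 3}, {1, 2, 3}, {1, 2, 3}, {1, 2, 3}] (by decide) m).trans
      (Fin.sum_univ_four _)]
    simp only [Matrix.cons_val, leftCount_three_0123, ih]
    ring

/-- The linear factor is a resonance: `{2, 3}` and its successor `{0, 2, 3}` are both kept by two
preferences. -/
theorem leftCount_three_23 (m : ℕ) : (leftCount 3 {2, 3} m : ℝ) =
    4 ^ m - 3 ^ m - 1 / 2 * (m : ℝ) * 2 ^ m := by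
  induction m with
  | zero =>
    rw [leftCount_zero, if_neg (by decide)]
    norm_num
  | succ m ih =>
    rw [(leftCount_succ_of_mem (by decide)
      ![{0, 2, 3}, {1, 2, 3}, {2, 3}, {2, 3}] (by decide) m).trans
      (Fin.sum_univ_four _)]
    simp only [Matrix.cons_val, leftCount_three_023, leftCount_three_123, ih]
    push_cast
    ring

theorem leftCount_three_012 (m : ℕ) : (leftCount 3 {0, 1, 2} (m + 1) : ℝ) =
    3 * 4 ^ m := by
  rw [leftCount_succ_of_notMem (by decide) ![{0, 1, 2, 3}, {0, 1, 2, 3}, {0, 1, 2, 3}] (by decide)]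
  simp only [Fin.sum_univ_three, Matrix.cons_val, leftCount_three_0123]
  ring

theorem leftCount_three_01 (m : ℕ) : (leftCount 3 {0, 1} (m + 2) : ℝ) =
    9 * 4 ^ m := by
  rw [leftCount_succ_of_notMem (by decide) ![{0, 1, 2}, {0, 1, 2}, {0, 1, 2}] (by decide)]
  simp only [Fin.sum_univ_three, Matrix.cons_val, leftCount_three_012]
  ring

theorem leftCount_three_02 (m : ℕ) : (leftCount 3 {0, 2} (m + 2) : ℝ) =
    10 * 4 ^ m - 2 * 2 ^ m := by
  rw [leftCount_succ_of_notMem (by decide) ![{0, 1, 2}, {0, 1, 2}, {0, 2, 3}] (by decide)]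
  simp only [Fin.sum_univ_three, Matrix.cons_val, leftCount_three_012, leftCount_three_023]
  ring

theorem leftCount_three_12 (m : ℕ) : (leftCount 3 {1, 2} (m + 2) : ℝ) =
    11 * 4 ^ m - 6 * 3 ^ m := by
  rw [leftCount_succ_of_notMem (by decide) ![{0, 1, 2}, {1, 2, 3}, {1, 2, 3}] (by decide)]
  simp only [Fin.sum_univ_three, Matrix.cons_val, leftCount_three_012, leftCount_three_123]
  ring

theorem leftCount_three_0 (m : ℕ) : (leftCount 3 {0} (m + 3) : ℝ) =
    28 * 4 ^ m - 2 * 2 ^ m := by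
  rw [leftCount_succ_of_notMem (by decide) ![{0, 1}, {0, 1}, {0, 2}] (by decide)]
  simp only [Fin.sum_univ_three, Matrix.cons_val, leftCount_three_01, leftCount_three_02]
  ring

theorem leftCount_three_1 (m : ℕ) : (leftCount 3 {1} (m + 3) : ℝ) =
    31 * 4 ^ m - 12 * 3 ^ m := by
  rw [leftCount_succ_of_notMem (by decide) ![{0, 1}, {1, 2}, {1, 2}] (by decide)]
  simp only [Fin.sum_univ_three, Matrix.cons_val, leftCount_three_01, leftCount_three_12]
  ring

theorem leftCount_three_2 (m : ℕ) : (leftCount 3 {2} (m + 3) : ℝ) =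
    37 * 4 ^ m - 15 * 3 ^ m - (6 + 2 * (m : ℝ)) * 2 ^ m := by
  rw [leftCount_succ_of_notMem (by decide) ![{0, 2}, {1, 2}, {2, 3}] (by decide)]
  simp only [Fin.sum_univ_three, Matrix.cons_val, leftCount_three_02, leftCount_three_12, leftCount_three_23]
  push_cast
  ring

theorem leftCount_three_empty (m : ℕ) : (leftCount 3 ∅ (m + 4) : ℝ) =
    96 * 4 ^ m - 27 * 3 ^ m - (8 + 2 * (m : ℝ)) * 2 ^ m := by
  rw [leftCount_succ_of_notMem (by decide) ![{0}, {1}, {2}] (by decide)]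
  simp only [Fin.sum_univ_three, Matrix.cons_val, leftCount_three_0, leftCount_three_1, leftCount_three_2]
  ring

theorem leftCount_four_01234 (m : ℕ) : (leftCount 4 {0, 1, 2, 3, 4} m : ℝ) =
    5 ^ m := by
  induction m with
  | zero =>
    rw [leftCount_zero, if_pos (by decide)]
    norm_num
  | succ m ih =>
    rw [(leftCount_succ_of_mem (by decide)
      ![{0, 1, 2, 3, 4}, {0, 1, 2, 3, 4}, {0, 1, 2, 3, 4}, {0, 1, 2, 3, 4}, {0, 1, 2, 3, 4}] (by decide) m).trans
      (Fin.sum_univ_five _)]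
    simp only [Matrix.cons_val, ih]
    ring

theorem leftCount_four_0134 (m : ℕ) : (leftCount 4 {0, 1, 3, 4} m : ℝ) =
    5 ^ m - 2 ^ m := by
  induction m with
  | zero =>
    rw [leftCount_zero, if_neg (by decide)]
    norm_num
  | succ m ih =>
    rw [(leftCount_succ_of_mem (by decide)
      ![{0, 1, 2, 3, 4}, {0, 1, 2, 3, 4}, {0, 1, 2, 3, 4}, {0, 1, 3, 4}, {0, 1, 3, 4}] (by decide) m).trans
      (Fin.sum_univ_five _)]
    simp only [Matrix.cons_val, leftCount_four_01234, ih]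
    ring

theorem leftCount_four_0234 (m : ℕ) : (leftCount 4 {0, 2, 3, 4} m : ℝ) =
    5 ^ m - 3 ^ m := by
  induction m with
  | zero =>
    rw [leftCount_zero, if_neg (by decide)]
    norm_num
  | succ m ih =>
    rw [(leftCount_succ_of_mem (by decide)
      ![{0, 1, 2, 3, 4}, {0, 1, 2, 3, 4}, {0, 2, 3, 4}, {0, 2, 3, 4}, {0, 2, 3, 4}] (by decide) m).trans
      (Fin.sum_univ_five _)]
    simp only [Matrix.cons_val, leftCount_four_01234, ih]
    ring

theorem leftCount_four_1234 (m : ℕ) : (leftCount 4 {1, 2, 3, 4} m : ℝ) =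
    5 ^ m - 4 ^ m := by
  induction m with
  | zero =>
    rw [leftCount_zero, if_neg (by decide)]
    norm_num
  | succ m ih =>
    rw [(leftCount_succ_of_mem (by decide)
      ![{0, 1, 2, 3, 4}, {1, 2, 3, 4}, {1, 2, 3, 4}, {1, 2, 3, 4}, {1, 2, 3, 4}] (by decide) m).trans
      (Fin.sum_univ_five _)]
    simp only [Matrix.cons_val, leftCount_four_01234, ih]
    ring

theorem leftCount_four_034 (m : ℕ) : (leftCount 4 {0, 3, 4} m : ℝ) =
    5 ^ m - 3 ^ m - (m : ℝ) * 2 ^ m := by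
  induction m with
  | zero =>
    rw [leftCount_zero, if_neg (by decide)]
    norm_num
  | succ m ih =>
    rw [(leftCount_succ_of_mem (by decide)
      ![{0, 1, 3, 4}, {0, 1, 3, 4}, {0, 2, 3, 4}, {0, 3, 4}, {0, 3, 4}] (by decide) m).trans
      (Fin.sum_univ_five _)]
    simp only [Matrix.cons_val, leftCount_four_0134, leftCount_four_0234, ih]
    push_cast
    ring

theorem leftCount_four_134 (m : ℕ) : (leftCount 4 {1, 3, 4} m : ℝ) =
    5 ^ m - 4 ^ m - 1 / 2 * (m : ℝ) * 2 ^ m := by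
  induction m with
  | zero =>
    rw [leftCount_zero, if_neg (by decide)]
    norm_num
  | succ m ih =>
    rw [(leftCount_succ_of_mem (by decide)
      ![{0, 1, 3, 4}, {1, 2, 3, 4}, {1, 2, 3, 4}, {1, 3, 4}, {1, 3, 4}] (by decide) m).trans
      (Fin.sum_univ_five _)]
    simp only [Matrix.cons_val, leftCount_four_0134, leftCount_four_1234, ih]
    push_cast
    ring

theorem leftCount_four_234 (m : ℕ) : (leftCount 4 {2, 3, 4} m : ℝ) =
    5 ^ m - 4 ^ m - 1 / 3 * (m : ℝ) * 3 ^ m := by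
  induction m with
  | zero =>
    rw [leftCount_zero, if_neg (by decide)]
    norm_num
  | succ m ih =>
    rw [(leftCount_succ_of_mem (by decide)
      ![{0, 2, 3, 4}, {1, 2, 3, 4}, {2, 3, 4}, {2, 3, 4}, {2, 3, 4}] (by decide) m).trans
      (Fin.sum_univ_five _)]
    simp only [Matrix.cons_val, leftCount_four_0234, leftCount_four_1234, ih]
    push_cast
    ring

/-- A second resonance: the successors `{0, 3, 4}` and `{1, 3, 4}` already carry `m * 2 ^ m`, hence
the quadratic factor. -/
theorem leftCount_four_34 (m : ℕ) : (leftCount 4 {3, 4} m : ℝ) =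
    5 ^ m - 4 ^ m - 1 / 3 * (m : ℝ) * 3 ^ m + (3 / 8 * (m : ℝ) - 3 / 8 * (m : ℝ) ^ 2) * 2 ^ m := by
  induction m with
  | zero =>
    rw [leftCount_zero, if_neg (by decide)]
    norm_num
  | succ m ih =>
    rw [(leftCount_succ_of_mem (by decide)
      ![{0, 3, 4}, {1, 3, 4}, {2, 3, 4}, {3, 4}, {3, 4}] (by decide) m).trans
      (Fin.sum_univ_five _)]
    simp only [Matrix.cons_val, leftCount_four_034, leftCount_four_134, leftCount_four_234, ih]
    push_cast
    ring

theorem leftCount_four_0123 (m : ℕ) : (leftCount 4 {0, 1, 2, 3} (m + 1) : ℝ) =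
    4 * 5 ^ m := by
  rw [leftCount_succ_of_notMem (by decide) ![{0, 1, 2, 3, 4}, {0, 1, 2, 3, 4}, {0, 1, 2, 3, 4}, {0, 1, 2, 3, 4}] (by decide)]
  simp only [Fin.sum_univ_four, Matrix.cons_val, leftCount_four_01234]
  ring

theorem leftCount_four_012 (m : ℕ) : (leftCount 4 {0, 1, 2} (m + 2) : ℝ) =
    16 * 5 ^ m := by
  rw [leftCount_succ_of_notMem (by decide) ![{0, 1, 2, 3}, {0, 1, 2, 3}, {0, 1, 2, 3}, {0, 1, 2, 3}] (by decide)]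
  simp only [Fin.sum_univ_four, Matrix.cons_val, leftCount_four_0123]
  ring

theorem leftCount_four_013 (m : ℕ) : (leftCount 4 {0, 1, 3} (m + 2) : ℝ) =
    17 * 5 ^ m - 2 * 2 ^ m := by
  rw [leftCount_succ_of_notMem (by decide) ![{0, 1, 2, 3}, {0, 1, 2, 3}, {0, 1, 2, 3}, {0, 1, 3, 4}] (by decide)]
  simp only [Fin.sum_univ_four, Matrix.cons_val, leftCount_four_0123, leftCount_four_0134]
  ring

theorem leftCount_four_023 (m : ℕ) : (leftCount 4 {0, 2, 3} (m + 2) : ℝ) =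
    18 * 5 ^ m - 6 * 3 ^ m := by
  rw [leftCount_succ_of_notMem (by decide) ![{0, 1, 2, 3}, {0, 1, 2, 3}, {0, 2, 3, 4}, {0, 2, 3, 4}] (by decide)]
  simp only [Fin.sum_univ_four, Matrix.cons_val, leftCount_four_0123, leftCount_four_0234]
  ring

theorem leftCount_four_123 (m : ℕ) : (leftCount 4 {1, 2, 3} (m + 2) : ℝ) =
    19 * 5 ^ m - 12 * 4 ^ m := by
  rw [leftCount_succ_of_notMem (by decide) ![{0, 1, 2, 3}, {1, 2, 3, 4}, {1, 2, 3, 4}, {1, 2, 3, 4}] (by decide)]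
  simp only [Fin.sum_univ_four, Matrix.cons_val, leftCount_four_0123, leftCount_four_1234]
  ring

theorem leftCount_four_01 (m : ℕ) : (leftCount 4 {0, 1} (m + 3) : ℝ) =
    65 * 5 ^ m - 2 * 2 ^ m := by
  rw [leftCount_succ_of_notMem (by decide) ![{0, 1, 2}, {0, 1, 2}, {0, 1, 2}, {0, 1, 3}] (by decide)]
  simp only [Fin.sum_univ_four, Matrix.cons_val, leftCount_four_012, leftCount_four_013]
  ring

theorem leftCount_four_02 (m : ℕ) : (leftCount 4 {0, 2} (m + 3) : ℝ) =
    68 * 5 ^ m - 12 * 3 ^ m := by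
  rw [leftCount_succ_of_notMem (by decide) ![{0, 1, 2}, {0, 1, 2}, {0, 2, 3}, {0, 2, 3}] (by decide)]
  simp only [Fin.sum_univ_four, Matrix.cons_val, leftCount_four_012, leftCount_four_023]
  ring

theorem leftCount_four_03 (m : ℕ) : (leftCount 4 {0, 3} (m + 3) : ℝ) =
    77 * 5 ^ m - 15 * 3 ^ m - (12 + 4 * (m : ℝ)) * 2 ^ m := by
  rw [leftCount_succ_of_notMem (by decide) ![{0, 1, 3}, {0, 1, 3}, {0, 2, 3}, {0, 3, 4}] (by decide)]
  simp only [Fin.sum_univ_four, Matrix.cons_val, leftCount_four_013, leftCount_four_023, leftCount_four_034]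
  push_cast
  ring

theorem leftCount_four_12 (m : ℕ) : (leftCount 4 {1, 2} (m + 3) : ℝ) =
    73 * 5 ^ m - 36 * 4 ^ m := by
  rw [leftCount_succ_of_notMem (by decide) ![{0, 1, 2}, {1, 2, 3}, {1, 2, 3}, {1, 2, 3}] (by decide)]
  simp only [Fin.sum_univ_four, Matrix.cons_val, leftCount_four_012, leftCount_four_123]
  ring

theorem leftCount_four_13 (m : ℕ) : (leftCount 4 {1, 3} (m + 3) : ℝ) =
    80 * 5 ^ m - 40 * 4 ^ m - (6 + 2 * (m : ℝ)) * 2 ^ m := by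
  rw [leftCount_succ_of_notMem (by decide) ![{0, 1, 3}, {1, 2, 3}, {1, 2, 3}, {1, 3, 4}] (by decide)]
  simp only [Fin.sum_univ_four, Matrix.cons_val, leftCount_four_013, leftCount_four_123, leftCount_four_134]
  push_cast
  ring

theorem leftCount_four_23 (m : ℕ) : (leftCount 4 {2, 3} (m + 3) : ℝ) =
    87 * 5 ^ m - 44 * 4 ^ m - (18 + 6 * (m : ℝ)) * 3 ^ m := by
  rw [leftCount_succ_of_notMem (by decide) ![{0, 2, 3}, {1, 2, 3}, {2, 3, 4}, {2, 3, 4}] (by decide)]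
  simp only [Fin.sum_univ_four, Matrix.cons_val, leftCount_four_023, leftCount_four_123, leftCount_four_234]
  push_cast
  ring

theorem leftCount_four_0 (m : ℕ) : (leftCount 4 {0} (m + 4) : ℝ) =
    275 * 5 ^ m - 27 * 3 ^ m - (16 + 4 * (m : ℝ)) * 2 ^ m := by
  rw [leftCount_succ_of_notMem (by decide) ![{0, 1}, {0, 1}, {0, 2}, {0, 3}] (by decide)]
  simp only [Fin.sum_univ_four, Matrix.cons_val, leftCount_four_01, leftCount_four_02, leftCount_four_03]
  ring

theorem leftCount_four_1 (m : ℕ) : (leftCount 4 {1} (m + 4) : ℝ) =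
    291 * 5 ^ m - 112 * 4 ^ m - (8 + 2 * (m : ℝ)) * 2 ^ m := by
  rw [leftCount_succ_of_notMem (by decide) ![{0, 1}, {1, 2}, {1, 2}, {1, 3}] (by decide)]
  simp only [Fin.sum_univ_four, Matrix.cons_val, leftCount_four_01, leftCount_four_12, leftCount_four_13]
  ring

theorem leftCount_four_2 (m : ℕ) : (leftCount 4 {2} (m + 4) : ℝ) =
    315 * 5 ^ m - 124 * 4 ^ m - (48 + 12 * (m : ℝ)) * 3 ^ m := by
  rw [leftCount_succ_of_notMem (by decide) ![{0, 2}, {1, 2}, {2, 3}, {2, 3}] (by decide)]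
  simp only [Fin.sum_univ_four, Matrix.cons_val, leftCount_four_02, leftCount_four_12, leftCount_four_23]
  ring

theorem leftCount_four_3 (m : ℕ) : (leftCount 4 {3} (m + 4) : ℝ) =
    369 * 5 ^ m - 148 * 4 ^ m - (60 + 15 * (m : ℝ)) * 3 ^ m - (36 + 21 * (m : ℝ) + 3 * (m : ℝ) ^ 2) * 2 ^ m := by
  rw [leftCount_succ_of_notMem (by decide) ![{0, 3}, {1, 3}, {2, 3}, {3, 4}] (by decide)]
  simp only [Fin.sum_univ_four, Matrix.cons_val, leftCount_four_03, leftCount_four_13, leftCount_four_23, leftCount_four_34]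
  push_cast
  ring

theorem leftCount_four_empty (m : ℕ) : (leftCount 4 ∅ (m + 5) : ℝ) =
    1250 * 5 ^ m - 384 * 4 ^ m - (135 + 27 * (m : ℝ)) * 3 ^ m - (60 + 27 * (m : ℝ) + 3 * (m : ℝ) ^ 2) * 2 ^ m := by
  rw [leftCount_succ_of_notMem (by decide) ![{0}, {1}, {2}, {3}] (by decide)]
  simp only [Fin.sum_univ_four, Matrix.cons_val, leftCount_four_0, leftCount_four_1, leftCount_four_2, leftCount_four_3]
  ring

/-! ### Evaluating the convolution and the exact counts. -/

/-- The factor `z.1 - t` comes from `wordCount_crit`; multiplying a falling factorial by `z.1`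
raises its order by one and adds `k` times itself. The last factor is arranged so that it visibly
vanishes at `x = t - k`, `y = n - t`. -/
theorem sum_choose_mul_descFactorial_mul_sub {n k t : ℕ} (hk : k < n) (x y : ℝ) :
    ∑ z ∈ Finset.HasAntidiagonal.antidiagonal n,
      (n.choose z.1 : ℝ) * (z.1.descFactorial k * x ^ z.1 * ((z.1 : ℝ) - t) * y ^ z.2) =
    n.descFactorial k * x ^ k * (x + y) ^ (n - k - 1) *
      (((n : ℝ) - k) * x + ((k : ℝ) - t) * (x + y)) := by
  have hdesc : ∀ m : ℕ, (m : ℝ) * m.descFactorial k =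
      m.descFactorial (k + 1) + k * m.descFactorial k := by
    intro m
    rw [Nat.descFactorial_succ]
    rcases Nat.lt_or_ge m k with h | h
    · simp [Nat.descFactorial_of_lt h]
    · push_cast [h]
      ring
  have hterm : ∀ z ∈ Finset.HasAntidiagonal.antidiagonal n,
      (n.choose z.1 : ℝ) * (z.1.descFactorial k * x ^ z.1 * ((z.1 : ℝ) - t) * y ^ z.2) =
      (n.choose z.1 : ℝ) * (z.1.descFactorial (k + 1) * x ^ z.1 * y ^ z.2) +
      ((k : ℝ) - t) * ((n.choose z.1 : ℝ) * (z.1.descFactorial k * x ^ z.1 * y ^ z.2)) := by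
    intro z _
    linear_combination ((n.choose z.1 : ℝ) * x ^ z.1 * y ^ z.2) * hdesc z.1
  rw [Finset.sum_congr rfl hterm, Finset.sum_add_distrib, ← Finset.mul_sum,
    sum_choose_mul_descFactorial, sum_choose_mul_descFactorial]
  have h1 := hdesc n
  obtain ⟨l, rfl⟩ : ∃ l, n = k + 1 + l := ⟨n - (k + 1), by omega⟩
  rw [show k + 1 + l - (k + 1) = l by omega, show k + 1 + l - k = l + 1 by omega,
    Nat.add_sub_cancel]
  linear_combination (-(x ^ (k + 1) * (x + y) ^ l)) * h1

/-- The number of parking functions with the lucky spot `t` when the number of unlucky left words is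
a suitable exponential polynomial. -/
theorem luckySpotCount_eq {n t : ℕ} (h : t < n) (c : ℝ) (d : ℕ → ℝ) (W : ℕ → ℝ)
    (hW : ∀ m, W m = c * ((t : ℝ) + 1) ^ m +
      ∑ k ∈ Finset.range t, d k * m.descFactorial k * ((t : ℝ) - k) ^ m)
    (hleft : ∀ m, (leftCount t ∅ (m + (t + 1)) : ℝ) = W (m + (t + 1))) :
    (luckySpotCount n (t + 1) : ℝ) = (1 - c) * ((n : ℝ) + 1) ^ (n - 1) -
      ∑ m ∈ Finset.range t,
        n.choose m * W m * ((t : ℝ) - m) * ((n : ℝ) - t) ^ (n - m - 1) := by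
  have hy : ((n : ℝ) - t) ≠ 0 := by
    have : (t : ℝ) < n := by exact_mod_cast h
    linarith
  have hcount := congrArg (Nat.cast : ℕ → ℝ) (parkingCount_eq_luckySpotCount_add h)
  rw [parkingCount_eq] at hcount
  push_cast at hcount
  -- Replace `leftCount` by `W` throughout. The `if` compensates for `z.1 < t`, where `leftCount` is
  -- zero; at `z.1 = t` the factor `z.1 - t` is zero.
  have hterm : ∀ z ∈ Finset.HasAntidiagonal.antidiagonal n,
      ((n : ℝ) - t) * ((n.choose z.1 : ℝ) * (leftCount t ∅ z.1 *
        wordCount (Finset.Ico (t + 1) n) (Crit (t + 1) n) z.2)) =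
      (n.choose z.1 : ℝ) * (W z.1 * ((z.1 : ℝ) - t) * ((n : ℝ) - t) ^ z.2) +
      if z.1 < t then (n.choose z.1 : ℝ) * (W z.1 * ((t : ℝ) - z.1) * ((n : ℝ) - t) ^ z.2)
        else 0 := by
    intro z hz
    have hz' := Finset.HasAntidiagonal.mem_antidiagonal.1 hz
    rcases Nat.lt_or_ge z.1 (t + 1) with hlt | hge
    · rw [leftCount_of_lt hlt]
      split_ifs with hzt
      · push_cast
        ring
      · have : z.1 = t := by omega
        rw [this]
        simp
    · have hzt : ¬ z.1 < t := by omega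
      obtain ⟨m, hm⟩ : ∃ m, z.1 = m + (t + 1) := ⟨z.1 - (t + 1), by omega⟩
      obtain ⟨s, hs⟩ : ∃ s, n = t + 1 + s := ⟨n - (t + 1), by omega⟩
      have hcrit := wordCount_crit s (t + 1) z.2 (by omega)
      have hsy : (s : ℝ) + 1 = (n : ℝ) - t := by
        rw [hs]; push_cast; ring
      have hzs : (s : ℝ) + 1 - z.2 = (z.1 : ℝ) - t := by
        rw [hsy, ← hz']; push_cast; ring
      rw [← hs, hzs, hsy] at hcrit
      rw [if_neg hzt, add_zero, hm, hleft, ← hm]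
      linear_combination ((n.choose z.1 : ℝ) * W z.1) * hcrit
  have hmain : ∑ z ∈ Finset.HasAntidiagonal.antidiagonal n,
      (n.choose z.1 : ℝ) * (W z.1 * ((z.1 : ℝ) - t) * ((n : ℝ) - t) ^ z.2) =
      ((n : ℝ) - t) * (c * ((n : ℝ) + 1) ^ (n - 1)) := by
    have hexp : ∀ z ∈ Finset.HasAntidiagonal.antidiagonal n,
        (n.choose z.1 : ℝ) * (W z.1 * ((z.1 : ℝ) - t) * ((n : ℝ) - t) ^ z.2) =
        c * ((n.choose z.1 : ℝ) * (z.1.descFactorial 0 * ((t : ℝ) + 1) ^ z.1 * ((z.1 : ℝ) - t) *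
          ((n : ℝ) - t) ^ z.2)) + ∑ k ∈ Finset.range t, d k * ((n.choose z.1 : ℝ) *
          (z.1.descFactorial k * ((t : ℝ) - k) ^ z.1 * ((z.1 : ℝ) - t) *
          ((n : ℝ) - t) ^ z.2)) := by
      intro z _
      rw [hW, Nat.descFactorial_zero, add_mul, add_mul, mul_add, Finset.sum_mul, Finset.sum_mul,
        Finset.mul_sum]
      congr 1
      · push_cast
        ring
      · exact Finset.sum_congr rfl fun k _ => by ring
    rw [Finset.sum_congr rfl hexp, Finset.sum_add_distrib, Finset.sum_comm, ← Finset.mul_sum,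
      sum_choose_mul_descFactorial_mul_sub (by omega)]
    -- With `x = t - k` and `x + y = n - k` the last factor is `(n-k)(t-k) + (k-t)(n-k) = 0`.
    have hzero : ∀ k ∈ Finset.range t, ∑ z ∈ Finset.HasAntidiagonal.antidiagonal n,
        d k * ((n.choose z.1 : ℝ) * (z.1.descFactorial k * ((t : ℝ) - k) ^ z.1 *
          ((z.1 : ℝ) - t) * ((n : ℝ) - t) ^ z.2)) = 0 := by
      intro k hk
      rw [← Finset.mul_sum,
        sum_choose_mul_descFactorial_mul_sub ((Finset.mem_range.1 hk).trans h)]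
      ring
    -- For the surviving term the last factor is `n(t+1) - t(n+1) = n - t`.
    rw [Finset.sum_congr rfl hzero, Finset.sum_const_zero, Nat.sub_zero, Nat.descFactorial_zero,
      show (t : ℝ) + 1 + ((n : ℝ) - t) = n + 1 by ring]
    push_cast
    ring
  have hcorr : (∑ z ∈ Finset.HasAntidiagonal.antidiagonal n, if z.1 < t then
      (n.choose z.1 : ℝ) * (W z.1 * ((t : ℝ) - z.1) * ((n : ℝ) - t) ^ z.2) else 0) =
      ((n : ℝ) - t) * ∑ m ∈ Finset.range t,
        n.choose m * W m * ((t : ℝ) - m) * ((n : ℝ) - t) ^ (n - m - 1) := by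
    rw [Finset.Nat.sum_antidiagonal_eq_sum_range_succ (fun i j => if i < t then
      (n.choose i : ℝ) * (W i * ((t : ℝ) - i) * ((n : ℝ) - t) ^ j) else 0), ← Finset.sum_filter]
    have hset : (Finset.range n.succ).filter (· < t) = Finset.range t := by
      ext x; simp; omega
    rw [hset, Finset.mul_sum]
    refine Finset.sum_congr rfl fun m hm => ?_
    have hm' := Finset.mem_range.1 hm
    rw [show n - m = n - m - 1 + 1 by omega, pow_succ, Nat.add_sub_cancel]
    ring
  have hU := Finset.sum_congr rfl hterm
  rw [← Finset.mul_sum, Finset.sum_add_distrib, hmain, hcorr, ← mul_add] at hU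
  rw [mul_left_cancel₀ hy hU] at hcount
  linear_combination (-1 : ℝ) * hcount

theorem luckySpotCount_one {n : ℕ} (h : 1 ≤ n) :
    (luckySpotCount n 1 : ℝ) = ((n : ℝ) + 1) ^ (n - 1) := by
  have key := luckySpotCount_eq h 0 0 0 (by simp) fun m => by
    rw [zero_add, leftCount_succ]
    simp
  simpa using key

theorem luckySpotCount_two {n : ℕ} (h : 2 ≤ n) : (luckySpotCount n 2 : ℝ) =
    3 / 4 * ((n : ℝ) + 1) ^ (n - 1) - 1 / 4 * ((n : ℝ) - 1) ^ (n - 1) := by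
  have key := luckySpotCount_eq h (1 / 4) 0 _ (fun _ => rfl) fun m => by
    rw [leftCount_one_empty]
    norm_num
    ring
  norm_num at key ⊢
  rw [key]

theorem luckySpotCount_three {n : ℕ} (h : 3 ≤ n) : (luckySpotCount n 3 : ℝ) =
    2 / 3 * ((n : ℝ) + 1) ^ (n - 1)
      - 1 / 3 * (2 * (n : ℝ) - 1) * ((n : ℝ) - 2) ^ (n - 2) := by
  have key := luckySpotCount_eq h (1 / 3) (fun k => if k = 0 then -1 / 4 else 0) _
      (fun _ => rfl) fun m => by
    rw [leftCount_two_empty]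
    norm_num [Finset.sum_range_succ, Nat.descFactorial_succ]
    ring
  rw [key]
  obtain ⟨l, rfl⟩ : ∃ l, n = l + 2 := ⟨n - 2, by omega⟩
  norm_num [Finset.sum_range_succ, Nat.descFactorial_succ]
  ring

theorem luckySpotCount_four {n : ℕ} (h : 4 ≤ n) : (luckySpotCount n 4 : ℝ) =
    5 / 8 * ((n : ℝ) + 1) ^ (n - 1)
      - 1 / 8 * (13 * (n : ℝ) ^ 2 - 26 * (n : ℝ) + 9) * ((n : ℝ) - 3) ^ (n - 3) := by
  have key := luckySpotCount_eq h (3 / 8) (fun k => if k = 0 then -1 / 3 else if k = 1 then -1 / 8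
      else 0) _ (fun _ => rfl) fun m => by
    rw [leftCount_three_empty]
    norm_num [Finset.sum_range_succ, Nat.descFactorial_succ]
    ring
  rw [key]
  obtain ⟨l, rfl⟩ : ∃ l, n = l + 3 := ⟨n - 3, by omega⟩
  have hexp : l + 3 - 2 - 1 = l := rfl
  norm_num [hexp, Finset.sum_range_succ, Nat.descFactorial_succ, Nat.cast_choose_two]
  ring

theorem luckySpotCount_five {n : ℕ} (h : 5 ≤ n) : (luckySpotCount n 5 : ℝ) =
    3 / 5 * ((n : ℝ) + 1) ^ (n - 1)
      - 1 / 30 * (118 * (n : ℝ) ^ 3 - 531 * (n : ℝ) ^ 2 + 659 * (n : ℝ) - 192)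
        * ((n : ℝ) - 4) ^ (n - 4) := by
  -- The coefficients rewrite `leftCount_four_empty` in the exponent `m + 5`: `1250 = 2/5 * 5^5`,
  -- `384 = 3/8 * 4^5`, `135 + 27m = 1/9 * 3^5 * (m+5)`, `60 + 27m + 3m^2 = 3/32 * 2^5 *
  -- (m+5)(m+4)`.
  have key := luckySpotCount_eq h (2 / 5) (fun k => if k = 0 then -3 / 8 else if k = 1 then -1 / 9
      else if k = 2 then -3 / 32 else 0) _ (fun _ => rfl) fun m => by
    rw [leftCount_four_empty]
    norm_num [Finset.sum_range_succ, Nat.descFactorial_succ]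
    ring
  rw [key]
  obtain ⟨l, rfl⟩ : ∃ l, n = l + 4 := ⟨n - 4, by omega⟩
  have hthree : ((l + 4).choose 3 : ℝ) = (l + 4) * (l + 3) * (l + 2) / 6 := by
    have := Nat.descFactorial_eq_factorial_mul_choose (l + 4) 3
    rw [show (l + 4).descFactorial 3 = (l + 2) * ((l + 3) * ((l + 4) * 1)) from rfl] at this
    have := congrArg (Nat.cast : ℕ → ℝ) this
    norm_num [Nat.factorial] at this
    linarith
  have hexp : l + 4 - 2 - 1 = l + 1 := rfl
  have hexp' : l + 4 - 3 - 1 = l := rfl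
  norm_num [hexp, hexp', Finset.sum_range_succ, Nat.descFactorial_succ, Nat.cast_choose_two, hthree]
  ring

/-! ### Column sums as lucky spot counts. -/

theorem IsOutcome.injective {n : ℕ} {p s : Fin n → Fin n} (h : IsOutcome p s) :
    Function.Injective s := by
  intro i k hik
  rcases lt_trichotomy i k with hlt | heq | hlt
  · exact absurd hik ((h k).1.2 i hlt)
  · exact heq
  · exact absurd hik.symm ((h i).1.2 k hlt)

/-- Only one car parks in a given spot, so the sets counted by `q n i j` for different `i` are
disjoint. -/
theorem columnSum_eq_luckySpotCount (n j : ℕ) : columnSum n j = luckySpotCount n j := by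
  have hunion : {p : Fin n → Fin n | ∃ t : Fin n, (t : ℕ) + 1 = j ∧ IsLuckySpot p t} =
      ⋃ i : Fin n, {p : Fin n → Fin n | (p i : ℕ) + 1 = j ∧ IsLuckyCar p i} := by
    ext p
    simp only [Set.mem_ofPred_eq, Set.mem_iUnion, IsLuckySpot, IsLuckyCar]
    constructor
    · rintro ⟨t, ht, s, hs, i, hi, rfl⟩
      exact ⟨i, ht, s, hs, hi⟩
    · rintro ⟨i, hi, s, hs, hsi⟩
      exact ⟨p i, hi, s, hs, i, hsi, rfl⟩
  rw [columnSum, luckySpotCount, hunion, Set.ncard_iUnion_of_finite, finsum_eq_sum_of_fintype]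
  · rfl
  · exact fun _ => Set.toFinite _
  · intro i k hik
    rw [Function.onFun, Set.disjoint_left]
    rintro p ⟨hi, s, hs, hsi⟩ ⟨hk, s', hs', hsk⟩
    obtain rfl := hs.unique hs'
    refine hik (hs.injective ?_)
    rw [hsi, hsk]
    exact Fin.ext (by omega)

/-! ### Limits. -/

theorem isAsymptoticProbability_of_tendsto {j : ℕ} {ρ : ℝ}
    (h : Tendsto (fun n : ℕ => (luckySpotCount n j : ℝ) / ((n : ℝ) + 1) ^ (n - 1)) atTop (𝓝 ρ)) :
    IsAsymptoticProbability j ρ := by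
  refine ⟨by simpa only [columnSum_eq_luckySpotCount] using h, ?_⟩
  simpa only [parkingCount_eq, Nat.cast_pow, Nat.cast_add, Nat.cast_one] using h

theorem tendsto_one_div_succ : Tendsto (fun n : ℕ => 1 / ((n : ℝ) + 1)) atTop (𝓝 0) :=
  tendsto_one_div_add_atTop_nhds_zero_nat

/-- The base is `1 - (t+1)/(n+1)`. Its power `n + 1` tends to the exponential, and the `t + 1`
excess factors tend to `1`. -/
theorem tendsto_sub_div_succ_pow (t : ℕ) :
    Tendsto (fun n : ℕ => (((n : ℝ) - t) / ((n : ℝ) + 1)) ^ (n - t)) atTop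
      (𝓝 (Real.exp (-((t : ℝ) + 1)))) := by
  have hnum : Tendsto (fun n : ℕ => (1 + -((t : ℝ) + 1) / ((n + 1 : ℕ) : ℝ)) ^ (n + 1)) atTop
      (𝓝 (Real.exp (-((t : ℝ) + 1)))) :=
    (Real.tendsto_one_add_div_pow_exp (-((t : ℝ) + 1))).comp (tendsto_add_atTop_nat 1)
  have hden : Tendsto (fun n : ℕ => (1 - ((t : ℝ) + 1) * (1 / ((n : ℝ) + 1))) ^ (t + 1)) atTop
      (𝓝 1) := by
    have := ((tendsto_one_div_succ.const_mul ((t : ℝ) + 1)).const_sub 1).pow (t + 1)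
    simpa only [mul_zero, sub_zero, one_pow] using this
  have hdiv := hnum.div hden one_ne_zero
  rw [div_one] at hdiv
  refine hdiv.congr' ?_
  filter_upwards [eventually_gt_atTop t] with n hn
  have hn' : (t : ℝ) < n := by exact_mod_cast hn
  have hpos : (0 : ℝ) < (n : ℝ) + 1 := by positivity
  have hne : ((n : ℝ) - t) / ((n : ℝ) + 1) ≠ 0 := div_ne_zero (by linarith) hpos.ne'
  have h1 : 1 + -((t : ℝ) + 1) / ((n + 1 : ℕ) : ℝ) = ((n : ℝ) - t) / ((n : ℝ) + 1) := by
    push_cast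
    field_simp
    ring
  have h2 : 1 - ((t : ℝ) + 1) * (1 / ((n : ℝ) + 1)) = ((n : ℝ) - t) / ((n : ℝ) + 1) := by
    field_simp
    ring
  rw [Pi.div_apply, h1, h2, div_eq_iff (pow_ne_zero _ hne), ← pow_add]
  congr 1
  omega

/-- In the applications `g` is the polynomial factor of the correction, divided by `(n+1)^(t-1)` and
written in `u = 1/(n+1)`; thus `g 0` is its leading coefficient. -/
theorem tendsto_div_succ_pow {t : ℕ} (ht : 1 ≤ t) {F : ℕ → ℝ} {a : ℝ} {g : ℝ → ℝ}
    (hg : Continuous g)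
    (hF : ∀ n : ℕ, t < n → F n = a * ((n : ℝ) + 1) ^ (n - 1) -
      g (1 / ((n : ℝ) + 1)) * ((n : ℝ) + 1) ^ (t - 1) * ((n : ℝ) - t) ^ (n - t)) :
    Tendsto (fun n : ℕ => F n / ((n : ℝ) + 1) ^ (n - 1)) atTop
      (𝓝 (a - g 0 * Real.exp (-((t : ℝ) + 1)))) := by
  have hlim := (((hg.tendsto 0).comp tendsto_one_div_succ).mul
    (tendsto_sub_div_succ_pow t)).const_sub a
  refine hlim.congr' ?_
  filter_upwards [eventually_gt_atTop t] with n hn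
  have hpos : (0 : ℝ) < (n : ℝ) + 1 := by positivity
  have hpow : ((n : ℝ) + 1) ^ (n - 1) = ((n : ℝ) + 1) ^ (t - 1) * ((n : ℝ) + 1) ^ (n - t) := by
    rw [← pow_add]
    congr 1
    omega
  rw [hF n hn, hpow, div_pow, Function.comp_apply]
  field_simp

theorem isAsymptoticProbability_one : IsAsymptoticProbability 1 1 := by
  refine isAsymptoticProbability_of_tendsto (tendsto_const_nhds.congr' ?_)
  filter_upwards [eventually_ge_atTop 1] with n hn
  rw [luckySpotCount_one hn, div_self (by positivity)]

theorem isAsymptoticProbability_two :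
    IsAsymptoticProbability 2 (3 / 4 - 1 / 4 * Real.exp (-2)) := by
  have key := tendsto_div_succ_pow (t := 1) le_rfl (F := fun n => (luckySpotCount n 2 : ℝ))
    (a := 3 / 4) (g := fun _ => 1 / 4) continuous_const fun n hn => by
      rw [luckySpotCount_two hn]
      simp
  norm_num at key
  exact isAsymptoticProbability_of_tendsto (by simpa using key)

theorem isAsymptoticProbability_three :
    IsAsymptoticProbability 3 (2 / 3 - 2 / 3 * Real.exp (-3)) := by
  have key := tendsto_div_succ_pow (t := 2) (by norm_num)
    (F := fun n => (luckySpotCount n 3 : ℝ)) (a := 2 / 3)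
    -- From `2n - 1 = 2(n+1) - 3`; the later choices of `g` likewise expand in powers of `n + 1`.
    (g := fun u => 1 / 3 * (2 - 3 * u)) (by fun_prop) fun n hn => by
      rw [luckySpotCount_three hn]
      have : (n : ℝ) + 1 ≠ 0 := by positivity
      push_cast
      field_simp
      ring
  norm_num at key
  exact isAsymptoticProbability_of_tendsto key

theorem isAsymptoticProbability_four :
    IsAsymptoticProbability 4 (5 / 8 - 13 / 8 * Real.exp (-4)) := by
  have key := tendsto_div_succ_pow (t := 3) (by norm_num)
    (F := fun n => (luckySpotCount n 4 : ℝ)) (a := 5 / 8)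
    (g := fun u => 1 / 8 * (13 - 52 * u + 48 * u ^ 2)) (by fun_prop) fun n hn => by
      rw [luckySpotCount_four hn]
      have : (n : ℝ) + 1 ≠ 0 := by positivity
      push_cast
      field_simp
      ring
  norm_num at key
  exact isAsymptoticProbability_of_tendsto key

theorem isAsymptoticProbability_five :
    IsAsymptoticProbability 5 (3 / 5 - 59 / 15 * Real.exp (-5)) := by
  have key := tendsto_div_succ_pow (t := 4) (by norm_num)
    (F := fun n => (luckySpotCount n 5 : ℝ)) (a := 3 / 5)
    (g := fun u => 1 / 30 * (118 - 885 * u + 2075 * u ^ 2 - 1500 * u ^ 3)) (by fun_prop)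
    fun n hn => by
      rw [luckySpotCount_five hn]
      have : (n : ℝ) + 1 ≠ 0 := by positivity
      push_cast
      field_simp
      ring
  norm_num at key
  exact isAsymptoticProbability_of_tendsto key

/-! ### Decimal expansions. -/

theorem exp_neg_natCast_mem_Ioo {k : ℕ} (hk : k ≠ 0) :
    Real.exp (-(k : ℝ)) ∈
      Set.Ioo ((2.7182818286 : ℝ) ^ k)⁻¹ ((2.7182818283 : ℝ) ^ k)⁻¹ := by
  have h : Real.exp (-(k : ℝ)) = (Real.exp 1 ^ k)⁻¹ := by
    rw [Real.exp_neg, ← Real.exp_nat_mul, mul_one]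
  rw [h]
  constructor
  · gcongr
    exact Real.exp_one_lt_d9
  · gcongr
    exact Real.exp_one_gt_d9

end Parking

theorem mainTheorem9 :
    -- the column sums are the numbers of parking functions with a given lucky spot
    (∀ n j : ℕ, Parking.columnSum n j = Parking.luckySpotCount n j) ∧
    -- the exact counts for the spots 3, 4, 5
    (∀ n : ℕ, 3 ≤ n → (Parking.luckySpotCount n 3 : ℝ) =
      2 / 3 * ((n : ℝ) + 1) ^ (n - 1)
        - 1 / 3 * (2 * (n : ℝ) - 1) * ((n : ℝ) - 2) ^ (n - 2)) ∧
    (∀ n : ℕ, 4 ≤ n → (Parking.luckySpotCount n 4 : ℝ) =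
      5 / 8 * ((n : ℝ) + 1) ^ (n - 1)
        - 1 / 8 * (13 * (n : ℝ) ^ 2 - 26 * (n : ℝ) + 9) * ((n : ℝ) - 3) ^ (n - 3)) ∧
    (∀ n : ℕ, 5 ≤ n → (Parking.luckySpotCount n 5 : ℝ) =
      3 / 5 * ((n : ℝ) + 1) ^ (n - 1)
        - 1 / 30 * (118 * (n : ℝ) ^ 3 - 531 * (n : ℝ) ^ 2 + 659 * (n : ℝ) - 192)
          * ((n : ℝ) - 4) ^ (n - 4)) ∧
    -- the limiting probabilities for the spots 1, …, 5
    Parking.IsAsymptoticProbability 1 1 ∧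
    Parking.IsAsymptoticProbability 2 (3 / 4 - 1 / 4 * Real.exp (-2)) ∧
    Parking.IsAsymptoticProbability 3 (2 / 3 - 2 / 3 * Real.exp (-3)) ∧
    Parking.IsAsymptoticProbability 4 (5 / 8 - 13 / 8 * Real.exp (-4)) ∧
    Parking.IsAsymptoticProbability 5 (3 / 5 - 59 / 15 * Real.exp (-5)) ∧
    -- their decimal expansions to six places
    (3 / 4 - 1 / 4 * Real.exp (-2) ∈ Set.Ico (0.716166 : ℝ) 0.716167) ∧
    (2 / 3 - 2 / 3 * Real.exp (-3) ∈ Set.Ico (0.633475 : ℝ) 0.633476) ∧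
    (5 / 8 - 13 / 8 * Real.exp (-4) ∈ Set.Ico (0.595237 : ℝ) 0.595238) ∧
    (3 / 5 - 59 / 15 * Real.exp (-5) ∈ Set.Ico (0.573497 : ℝ) 0.573498) := by
  refine ⟨Parking.columnSum_eq_luckySpotCount, fun n => Parking.luckySpotCount_three,
    fun n => Parking.luckySpotCount_four, fun n => Parking.luckySpotCount_five,
    Parking.isAsymptoticProbability_one, Parking.isAsymptoticProbability_two,
    Parking.isAsymptoticProbability_three, Parking.isAsymptoticProbability_four,
    Parking.isAsymptoticProbability_five, ?_, ?_, ?_, ?_⟩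
  · have h := Parking.exp_neg_natCast_mem_Ioo (k := 2) (by norm_num)
    norm_num at h
    constructor <;> linarith
  · have h := Parking.exp_neg_natCast_mem_Ioo (k := 3) (by norm_num)
    norm_num at h
    constructor <;> linarith
  · have h := Parking.exp_neg_natCast_mem_Ioo (k := 4) (by norm_num)
    norm_num at h
    constructor <;> linarith
  · have h := Parking.exp_neg_natCast_mem_Ioo (k := 5) (by norm_num)
    norm_num at h
    constructor <;> linarith
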